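/- Let $U$ be the open unit disk in $\mathbb{R}^{2n}$ with the standard symplectic form $\omega=\sum_{i=1}^n dx^i\wedge dx^{n+i}$, and let $\mathcal{A}^k$ be the space of smooth real $k$-forms on $U$. Let $L A=\omega\wedge A$ and $\Lambda A=\sum_{i=1}^n \iota_{\partial_{n+i}}\iota_{\partial_i}A$, and let $\mathcal{B}^s=\ker\Lambda\cap\mathcal{A}^s$ be the space of primitive $s$-forms. Every $A\in\mathcal{A}^k$ has a unique Lefschetz decomposition $A=\sum_{\max(0,k-n)\le r\le k/2}L^rB_{k-2r}$ with $B_{k-2r}\in\mathcal{B}^{k-2r}$. Define linear operators as follows. $\Pi^p$ keeps the terms with $r\le p$ of the decomposition. The reflection $*_r$ is given by $*_r(L^rB_s)=L^{n-r-s}B_s$ for $B_s\in\mathcal{B}^s$, $r+s\le n$. The operators $\partial_\pm: L^r\mathcal{B}^s\to L^r\mathcal{B}^{s\pm1}$ are determined by $d=\partial_++L\,\partial_-$. Finally $d_+=\Pi^p\circ d$ and $d_-=*_r\,d\,*_r$. For $0\le p\le n$ and $0\le k\le n+p$ let $F^p\mathcal{A}^k=\{A\in\mathcal{A}^k:\Lambda^{p+1}A=0\}=\Pi^p\mathcal{A}^k$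 be the space of $p$-filtered $k$-forms, and consider the elliptic complex $$0\to F^p\mathcal{A}^0\xrightarrow{d_+}F^p\mathcal{A}^1\xrightarrow{d_+}\cdots\xrightarrow{d_+}F^p\mathcal{A}^{n+p}\xrightarrow{\partial_+\partial_-}F^p\mathcal{A}^{n+p}\xrightarrow{d_-}F^p\mathcal{A}^{n+p-1}\xrightarrow{d_-}\cdots\xrightarrow{d_-}F^p\mathcal{A}^0\to0 .$$ Denote its cohomology at the term $F^p\mathcal{A}^k$ in the first half by $F^pH_+^k(U)$, and at the term $F^p\mathcal{A}^k$ in the second half by $F^pH_-^k(U)$; in particular $F^pH_+^{n+p}(U)=\ker(\partial_+\partial_-)\cap F^p\mathcal{A}^{n+p}/d_+(F^p\mathcal{A}^{n+p-1})$ and $F^pH_-^{n+p}(U)=\ker(d_-)\cap F^p\mathcal{A}^{n+p}/\partial_+\partial_-(F^p\mathcal{A}^{n+p})$. 1. ($d_+$-Poincaré lemma) If $0\le p<n$, then $\dim F^pH_+^0(U)=\dim F^pH_+^{2p+1}(U)=1$, and $\dim F^pH_+^k(U)=0$ for all $1\le k\le n+p-1$ with $k\ne 2p+1$. 2. ($d_-$-Poincaré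 lemma) If $0<p<n$, then $\dim F^pH_-^k(U)=0$ for all $0\le k\le n+p-1$. 3. If $0\le p\le n$, then all the cohomology spaces $F^pH_\pm^k(U)$, $0\le k\le n+p$, are finite-dimensional, and the index of the complex is zero: $$\sum_{k=0}^{n+p}(-1)^k\dim F^pH_+^k(U)+\sum_{k=0}^{n+p}(-1)^{2n+2p+1-k}\dim F^pH_-^k(U)=0 .$$ -/

import Mathlib

open scoped ContDiff

noncomputable section

/-! ### The Lefschetz decomposition of an `sl(2)`-module with bounded weights -/

section SlTwo

variable {M : Type*} [AddCommGroup M] [Module ℝ M]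

/-- `X` lowers and `Y` raises the weight by two, `[Y, X]` acts on weight `w` as `w`, and there are
no weights outside `[-n, n]`. -/
structure SlTwoData (X Y : Module.End ℝ M) (G : ℤ → Submodule ℝ M) (n : ℕ) : Prop where
  comm : ∀ w, ∀ v ∈ G w, Y (X v) = X (Y v) + (w : ℝ) • v
  lower : ∀ w, ∀ v ∈ G w, X v ∈ G (w - 2)
  raise : ∀ w, ∀ v ∈ G w, Y v ∈ G (w + 2)
  bound : ∀ w : ℤ, (n : ℤ) < |w| → G w = ⊥

namespace SlTwoData

variable {X Y : Module.End ℝ M} {G : ℤ → Submodule ℝ M} {n : ℕ}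

theorem swap (h : SlTwoData X Y G n) : SlTwoData Y X (fun w => G (-w)) n where
  comm w v hv := by
    have := h.comm _ v hv
    rw [this]; push_cast; module
  lower w v hv := by
    have := h.raise _ v hv
    rwa [show -w + 2 = -(w - 2) by ring] at this
  raise w v hv := by
    have := h.lower _ v hv
    rwa [show -w - 2 = -(w + 2) by ring] at this
  bound w hw := h.bound _ (by rwa [abs_neg])

theorem pow_lower (h : SlTwoData X Y G n) (r : ℕ) {w : ℤ} {v : M} (hv : v ∈ G w) :
    (X ^ r) v ∈ G (w - 2 * r) := by
  induction r with
  | zero => simpa using hv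
  | succ r ih =>
    have := h.lower _ _ ih
    rw [pow_succ', Module.End.mul_apply, show w - 2 * ((r + 1 : ℕ) : ℤ) = w - 2 * r - 2 by
      push_cast; ring]
    exact this

/-- `Y X^{r+1} v = (r+1)(w-r) X^r v` for a highest weight vector `v`. -/
theorem raise_pow (h : SlTwoData X Y G n) (r : ℕ) {w : ℤ} {v : M} (hv : v ∈ G w) (hY : Y v = 0) :
    Y ((X ^ (r + 1)) v) = (((r : ℝ) + 1) * ((w : ℝ) - r)) • (X ^ r) v := by
  induction r with
  | zero => simp [h.comm w v hv, hY]
  | succ r ih =>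
    have h1 := h.comm _ _ (h.pow_lower (r + 1) hv)
    have h2 : X (Y ((X ^ (r + 1)) v)) = (((r : ℝ) + 1) * ((w : ℝ) - r)) • (X ^ (r + 1)) v := by
      rw [ih, map_smul, pow_succ' X r]; rfl
    rw [pow_succ' X (r + 1), Module.End.mul_apply, h1, h2, ← add_smul]
    congr 1
    push_cast; ring

/-- `Y^m X^m` acts on a highest weight vector of weight `w ≥ m` as a nonzero scalar. -/
theorem pow_raise_pow (h : SlTwoData X Y G n) (m j : ℕ) {w : ℤ} (hw : (m : ℤ) + j ≤ w) :
    ∃ c : ℝ, c ≠ 0 ∧ ∀ v ∈ G w, Y v = 0 → (Y ^ m) ((X ^ (m + j)) v) = c • (X ^ j) v := by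
  induction m with
  | zero => exact ⟨1, one_ne_zero, fun v _ _ => by simp⟩
  | succ m ih =>
    obtain ⟨c, hc, hcv⟩ := ih (by push_cast at hw; linarith)
    refine ⟨c * (((m + j : ℕ) + 1) * ((w : ℝ) - (m + j : ℕ))), ?_, fun v hv hY => ?_⟩
    · refine mul_ne_zero hc (mul_ne_zero (by positivity) ?_)
      have : ((m : ℝ) + 1 + j) ≤ w := by exact_mod_cast hw
      push_cast
      intro h0
      linarith
    · rw [pow_succ, Module.End.mul_apply, show m + 1 + j = (m + j) + 1 by ring,
        h.raise_pow (m + j) hv hY, map_smul, hcv v hv hY, smul_smul, mul_comm]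

theorem pow_raise_pow_eq_zero (h : SlTwoData X Y G n) (r m : ℕ) (hm : r < m) {w : ℤ} {v : M}
    (hv : v ∈ G w) (hY : Y v = 0) : (Y ^ m) ((X ^ r) v) = 0 := by
  induction r generalizing m with
  | zero =>
    obtain ⟨m, rfl⟩ := Nat.exists_eq_add_of_lt hm
    rw [zero_add, pow_succ]; simp [hY]
  | succ r ih =>
    obtain ⟨m, rfl⟩ : ∃ m', m = m' + 1 := ⟨m - 1, by omega⟩
    rw [pow_succ, Module.End.mul_apply, h.raise_pow r hv hY, map_smul, ih m (by omega), smul_zero]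

theorem pow_large (h : SlTwoData X Y G n) {w : ℤ} {v : M} (hv : v ∈ G w) :
    ∃ N, (X ^ N) v = 0 := by
  refine ⟨(n + w.natAbs + 1), ?_⟩
  have h1 := h.pow_lower (n + w.natAbs + 1) hv
  rw [h.bound _ ?_] at h1
  · simpa using h1
  · have h2 : w - 2 * ((n + w.natAbs + 1 : ℕ) : ℤ) < -n := by omega
    have := neg_le_abs (w - 2 * ((n + w.natAbs + 1 : ℕ) : ℤ))
    linarith

theorem eq_zero_of_neg (h : SlTwoData X Y G n) {w : ℤ} (hw : w < 0) {v : M} (hv : v ∈ G w)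
    (hY : Y v = 0) : v = 0 := by
  obtain ⟨N, hN⟩ := h.pow_large hv
  induction N with
  | zero => simpa using hN
  | succ N ih =>
    apply ih
    have h1 := h.raise_pow N hv hY
    rw [hN, map_zero] at h1
    refine (smul_eq_zero.1 h1.symm).resolve_left (mul_ne_zero (by positivity) ?_)
    have h2 : (w : ℝ) < 0 := by exact_mod_cast hw
    have h3 : (0 : ℝ) ≤ N := by positivity
    intro h0; linarith

theorem pow_eq_zero (h : SlTwoData X Y G n) {w : ℕ} {v : M} (hv : v ∈ G w)
    (hY : Y v = 0) : (X ^ (w + 1)) v = 0 := by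
  refine h.eq_zero_of_neg (w := w - 2 * (w + 1 : ℕ)) (by push_cast; linarith)
    (h.pow_lower _ hv) ?_
  rw [h.raise_pow w hv hY]
  simp

theorem mem_of_nonneg (h : SlTwoData X Y G n) (S : Submodule ℝ M) {w : ℤ} (hw : 0 ≤ w)
    (hS : ∀ m : ℕ, ∀ u ∈ G (w + 2 * m), Y u = 0 → (X ^ m) u ∈ S) {v : M} (hv : v ∈ G w) :
    v ∈ S := by
  obtain ⟨N, hN⟩ := h.swap.pow_large (w := -w) (v := v) (by simpa using hv)
  induction N generalizing v with
  | zero => simp at hN; simp [hN]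
  | succ m ih =>
    have hu : (Y ^ m) v ∈ G (w + 2 * m) := by
      have := h.swap.pow_lower m (w := -w) (v := v) (by simpa using hv)
      simpa [sub_eq_add_neg, add_comm] using this
    have hYu : Y ((Y ^ m) v) = 0 := by rw [← Module.End.mul_apply, ← pow_succ']; exact hN
    obtain ⟨c, hc, hcv⟩ := h.pow_raise_pow m 0 (w := w + 2 * m) (by push_cast; linarith)
    have h1 := hcv _ hu hYu
    simp only [add_zero, pow_zero, Module.End.one_apply] at h1
    have h2 := hS m _ hu hYu
    have h3 : (X ^ m) ((Y ^ m) v) ∈ G w := by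
      have := h.pow_lower m hu
      simpa using this
    have h4 : v - c⁻¹ • (X ^ m) ((Y ^ m) v) ∈ S := by
      refine ih (sub_mem hv (Submodule.smul_mem _ _ h3)) ?_
      rw [map_sub, map_smul, h1, smul_smul, inv_mul_cancel₀ hc, one_smul, sub_self]
    have := add_mem h4 (Submodule.smul_mem _ c⁻¹ h2)
    simpa using this

/-- Every vector of a fixed weight is a sum of vectors `X^m u` with `u` a highest weight vector
of weight at least `m`. -/
theorem mem_span (h : SlTwoData X Y G n) (S : Submodule ℝ M)
    (hS : ∀ m w : ℕ, m ≤ w → ∀ u ∈ G w, Y u = 0 → (X ^ m) u ∈ S) (w : ℤ) {v : M}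
    (hv : v ∈ G w) : v ∈ S := by
  rcases le_total 0 w with hw | hw
  · refine h.mem_of_nonneg S hw (fun m u hu hYu => ?_) hv
    obtain ⟨w, rfl⟩ := Int.eq_ofNat_of_zero_le hw
    exact hS m (w + 2 * m) (by omega) u (by simpa using hu) hYu
  · refine h.swap.mem_of_nonneg S (w := -w) (by omega) (fun m u hu hXu => ?_) (by simpa using hv)
    obtain ⟨a, ha⟩ := Int.eq_ofNat_of_zero_le (a := -w) (by omega)
    rw [ha] at hu
    have hu' : u ∈ G (-((a + 2 * m : ℕ) : ℤ)) := by simpa using hu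
    -- the highest weight vector of the string of `u`
    have hE : (Y ^ (a + 2 * m)) u ∈ G (a + 2 * m : ℕ) := by
      have := h.swap.pow_lower (a + 2 * m) (w := (a + 2 * m : ℕ)) (v := u) hu'
      convert this using 2
      push_cast; ring
    have hYE : Y ((Y ^ (a + 2 * m)) u) = 0 := by
      have := h.swap.pow_eq_zero (w := a + 2 * m) hu' hXu
      rw [← Module.End.mul_apply, ← pow_succ']
      exact this
    obtain ⟨c, hc, hcv⟩ := h.swap.pow_raise_pow (a + m) m (w := (a + 2 * m : ℕ))
      (by push_cast; linarith)
    have h1 := hcv u hu' hXu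
    rw [show a + m + m = a + 2 * m by ring] at h1
    have h2 := hS (a + m) (a + 2 * m) (by omega) _ hE hYE
    rw [h1] at h2
    have h3 := S.smul_mem c⁻¹ h2
    rwa [smul_smul, inv_mul_cancel₀ hc, one_smul] at h3

end SlTwoData

end SlTwo

namespace FilteredForms

/-! ### Differential forms on the open unit disk of the standard symplectic space -/

/-- The Euclidean space of dimension `2n`.  The coordinate with index `Sum.inl i` is `x^i` and the
coordinate with index `Sum.inr i` is `x^{n+i}`. -/
abbrev Space (n : ℕ) : Type := EuclideanSpace ℝ (Fin n ⊕ Fin n)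

/-- The open unit disk `U`. -/
def disk (n : ℕ) : Set (Space n) := Metric.ball 0 1

/-- Alternating `k`-linear forms on the tangent space. -/
abbrev Alt (n k : ℕ) : Type := Space n [⋀^Fin k]→L[ℝ] ℝ

/-- The coordinate covector `dx^a`. -/
def dx {n : ℕ} (a : Fin n ⊕ Fin n) : Space n →L[ℝ] ℝ := EuclideanSpace.proj a

/-- The coordinate vector `∂/∂x^a`. -/
def basisVec {n : ℕ} (a : Fin n ⊕ Fin n) : Space n := EuclideanSpace.single a 1

/-- The real vector space of smooth differential forms on `U`, of all degrees: `A k` is the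
component of degree `k` of `A`.  A form on `U` is written as a function on the whole space which is
smooth on `U` and which is extended by zero outside `U`, so that two forms are equal if and only
if they are equal on `U`.  (There are no nonzero components in degrees above `2n`, so that the
product over all degrees is the direct sum.) -/
def formSubmodule (n : ℕ) : Submodule ℝ (∀ k : ℕ, Space n → Alt n k) where
  carrier := {A | ∀ k, ContDiffOn ℝ ∞ (A k) (disk n) ∧ ∀ x ∉ disk n, A k x = 0}
  add_mem' := fun {A B} hA hB k =>
    ⟨(hA k).1.add (hB k).1, fun x hx => by
      simp [(hA k).2 x hx, (hB k).2 x hx]⟩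
  zero_mem' := fun k => ⟨contDiffOn_const, fun _ _ => rfl⟩
  smul_mem' := fun c A hA k =>
    ⟨(hA k).1.const_smul c, fun x hx => by simp [(hA k).2 x hx]⟩

theorem mem_Form {n : ℕ} {A : ∀ k : ℕ, Space n → Alt n k} :
    A ∈ formSubmodule n ↔ ∀ k, ContDiffOn ℝ ∞ (A k) (disk n) ∧ ∀ x ∉ disk n, A k x = 0 := Iff.rfl

/-- The smooth differential forms on `U`, as a type. -/
def Form (n : ℕ) : Type := formSubmodule n

/-- The form with the components `A k`. -/
def Form.mk {n : ℕ} (A : ∀ k : ℕ, Space n → Alt n k) (h : A ∈ formSubmodule n) : Form n := ⟨A, h⟩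

@[simp] theorem Form.mk_val {n : ℕ} (A : ∀ k : ℕ, Space n → Alt n k) (h : A ∈ formSubmodule n) :
    (Form.mk A h).1 = A := rfl

instance (n : ℕ) : AddCommGroup (Form n) := inferInstanceAs (AddCommGroup (formSubmodule n))

instance (n : ℕ) : Module ℝ (Form n) := inferInstanceAs (Module ℝ (formSubmodule n))

@[ext] theorem Form.ext {n : ℕ} {A B : Form n} (h : ∀ k x, A.1 k x = B.1 k x) : A = B :=
  Subtype.ext (funext fun k => funext fun x => h k x)

@[simp] theorem Form.add_val {n : ℕ} (A B : Form n) : (A + B).1 = A.1 + B.1 := rfl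
@[simp] theorem Form.sub_val {n : ℕ} (A B : Form n) : (A - B).1 = A.1 - B.1 := rfl
@[simp] theorem Form.neg_val {n : ℕ} (A : Form n) : (-A).1 = -A.1 := rfl
@[simp] theorem Form.zero_val {n : ℕ} : (0 : Form n).1 = 0 := rfl
@[simp] theorem Form.smul_val {n : ℕ} (c : ℝ) (A : Form n) : (c • A).1 = c • A.1 := rfl

@[simp] theorem Form.sum_val {n : ℕ} {ι : Type*} (s : Finset ι) (A : ι → Form n) :
    (∑ i ∈ s, A i).1 = ∑ i ∈ s, (A i).1 :=
  map_sum (formSubmodule n).subtype (fun i => (show formSubmodule n from A i)) s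

/-- The space `𝒜^k` of forms which are homogeneous of degree `k`. -/
def homog (n k : ℕ) : Submodule ℝ (Form n) where
  carrier := {A | ∀ j, j ≠ k → A.1 j = 0}
  add_mem' := fun {A B} hA hB j hj => by
    change A.1 j + B.1 j = 0
    rw [hA j hj, hB j hj, add_zero]
  zero_mem' := fun j _ => rfl
  smul_mem' := fun c A hA j hj => by
    change c • A.1 j = 0
    rw [hA j hj, smul_zero]

/-- The homogeneous component of degree `k` of a form, as a form. -/
def degPart (n k : ℕ) : Form n →ₗ[ℝ] Form n where
  toFun A := Form.mk (fun j => if j = k then A.1 j else 0) <| mem_Form.2 fun j => by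
    by_cases h : j = k
    · simpa [h] using mem_Form.1 A.2 j
    · simp only [h, if_false]
      exact ⟨contDiffOn_const, fun _ _ => rfl⟩
  map_add' A B := by
    ext1 j x
    by_cases h : j = k <;> simp [h]
  map_smul' c A := by
    ext1 j x
    by_cases h : j = k <;> simp [h]

/-- The components of the exterior derivative of a form on `U`. -/
def dFun (n : ℕ) (A : ∀ k : ℕ, Space n → Alt n k) : ∀ k : ℕ, Space n → Alt n k
  | 0 => 0
  | k + 1 => (disk n).indicator (extDeriv (A k))

theorem dFun_mem {n : ℕ} (A : Form n) : dFun n A.1 ∈ formSubmodule n := by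
  refine mem_Form.2 fun k => ?_
  cases k with
  | zero => exact ⟨contDiffOn_const, fun _ _ => rfl⟩
  | succ k =>
    refine ⟨?_, fun x hx => Set.indicator_of_notMem hx _⟩
    have h1 : ContDiffOn ℝ ∞ (fderiv ℝ (A.1 k)) (disk n) :=
      (mem_Form.1 A.2 k).1.fderiv_of_isOpen Metric.isOpen_ball le_rfl
    have h2 := (ContinuousAlternatingMap.alternatizeUncurryFinCLM ℝ (Space n) ℝ
      (n := k)).contDiff.comp_contDiffOn (n := ∞) h1
    exact h2.congr fun x hx => Set.indicator_of_mem hx _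

/-- The exterior derivative of forms on `U`. -/
def d (n : ℕ) : Form n →ₗ[ℝ] Form n where
  toFun A := Form.mk (dFun n A.1) (dFun_mem A)
  map_add' A B := by
    ext1 k x
    cases k with
    | zero => simp [dFun]
    | succ k =>
      by_cases hx : x ∈ disk n
      · have hn : disk n ∈ nhds x := Metric.isOpen_ball.mem_nhds hx
        have hA := ((mem_Form.1 A.2 k).1.contDiffAt hn).differentiableAt (by simp)
        have hB := ((mem_Form.1 B.2 k).1.contDiffAt hn).differentiableAt (by simp)
        simpa [dFun, hx] using extDeriv_add hA hB
      · simp [dFun, hx]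
  map_smul' c A := by
    ext1 k x
    cases k with
    | zero => simp [dFun]
    | succ k =>
      by_cases hx : x ∈ disk n
      · simpa [dFun, hx] using extDeriv_smul (x := x) c (A.1 k)
      · simp [dFun, hx]

/-- Exterior multiplication `A ↦ α ∧ A` of an alternating form by a covector `α`:
`(α ∧ A)(v_0, …, v_k) = ∑ i, (-1)^i α(v_i) A(v_0, …, v_{i-1}, v_{i+1}, …, v_k)`. -/
def wedgeCLM {n : ℕ} (α : Space n →L[ℝ] ℝ) (k : ℕ) : Alt n k →L[ℝ] Alt n (k + 1) :=
  (ContinuousAlternatingMap.alternatizeUncurryFinCLM ℝ (Space n) ℝ).comp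
    (ContinuousLinearMap.smulRightL ℝ (Space n) (Alt n k) α)

/-- Interior multiplication `A ↦ ι_v A`, with `(ι_v A)(v_1, …, v_k) = A(v, v_1, …, v_k)`. -/
def contractCLM {n : ℕ} (v : Space n) (k : ℕ) : Alt n (k + 1) →L[ℝ] Alt n k :=
  (ContinuousLinearMap.apply ℝ (Alt n k) v).comp
    (ContinuousAlternatingMap.curryLeftLI (𝕜 := ℝ) (E := Space n) (F := ℝ)
      (n := k)).toContinuousLinearMap

/-- The components of `dx^a ∧ A`. -/
def wedgeFun {n : ℕ} (a : Fin n ⊕ Fin n) (A : ∀ k : ℕ, Space n → Alt n k) :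
    ∀ k : ℕ, Space n → Alt n k
  | 0 => 0
  | k + 1 => fun x => wedgeCLM (dx a) k (A k x)

/-- `A ↦ dx^a ∧ A` on forms. -/
def wedgeCoord {n : ℕ} (a : Fin n ⊕ Fin n) : Module.End ℝ (Form n) where
  toFun A := Form.mk (wedgeFun a A.1) <| mem_Form.2 fun k => by
    cases k with
    | zero => exact ⟨contDiffOn_const, fun _ _ => rfl⟩
    | succ k =>
      exact ⟨(wedgeCLM (dx a) k).contDiff.comp_contDiffOn (mem_Form.1 A.2 k).1, fun x hx => by
        simp [wedgeFun, (mem_Form.1 A.2 k).2 x hx]⟩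
  map_add' A B := by
    ext1 k x
    cases k <;> simp [wedgeFun]
  map_smul' c A := by
    ext1 k x
    cases k <;> simp [wedgeFun]

/-- `A ↦ ι_{∂/∂x^a} A` on forms. -/
def contractCoord {n : ℕ} (a : Fin n ⊕ Fin n) : Module.End ℝ (Form n) where
  toFun A := Form.mk (fun k x => contractCLM (basisVec a) k (A.1 (k + 1) x)) <| mem_Form.2 fun k =>
    ⟨(contractCLM (basisVec a) k).contDiff.comp_contDiffOn (mem_Form.1 A.2 (k + 1)).1,
      fun x hx => by simp [(mem_Form.1 A.2 (k + 1)).2 x hx]⟩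
  map_add' A B := by
    ext1 k x
    simp
  map_smul' c A := by
    ext1 k x
    simp

/-! ### The Lefschetz operators and the Lefschetz decomposition -/

/-- The Lefschetz operator `L A = ω ∧ A` for the standard symplectic form
`ω = ∑ i, dx^i ∧ dx^{n+i}`. -/
def L (n : ℕ) : Module.End ℝ (Form n) :=
  ∑ i : Fin n, wedgeCoord (Sum.inl i) * wedgeCoord (Sum.inr i)

/-- The dual Lefschetz operator `Λ A = (1/2) ∑ (ω⁻¹)^{ab} ι_{∂_a} ι_{∂_b} A`.  For the standard
symplectic form `(ω⁻¹)^{n+i,i} = 1 = -(ω⁻¹)^{i,n+i}`, and all other entries vanish. -/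
def Lam (n : ℕ) : Module.End ℝ (Form n) :=
  ∑ i : Fin n, contractCoord (Sum.inr i) * contractCoord (Sum.inl i)

/-! ### The commutation relation `[Λ, L] = H` -/

theorem wedgeCLM_apply {n k : ℕ} (α : Space n →L[ℝ] ℝ) (A : Alt n k) (v : Fin (k + 1) → Space n) :
    wedgeCLM α k A v = ∑ i : Fin (k + 1), (-1 : ℝ) ^ (i : ℕ) * (α (v i) * A (i.removeNth v)) := by
  simp [wedgeCLM, ContinuousAlternatingMap.alternatizeUncurryFin_apply]

theorem contractCLM_apply {n k : ℕ} (u : Space n) (A : Alt n (k + 1)) (v : Fin k → Space n) :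
    contractCLM u k A v = A (Matrix.vecCons u v) := rfl

theorem contract_wedge {n k : ℕ} (α : Space n →L[ℝ] ℝ) (u : Space n) (A : Alt n (k + 1)) :
    contractCLM u (k + 1) (wedgeCLM α (k + 1) A) =
      α u • A - wedgeCLM α k (contractCLM u k A) := by
  ext v
  have h : (α u • A - wedgeCLM α k (contractCLM u k A)) v =
      α u * A v + ∑ i : Fin (k + 1),
        -((-1 : ℝ) ^ (i : ℕ) * (α (v i) * A (Matrix.vecCons u (i.removeNth v)))) := by
    rw [Finset.sum_neg_distrib, ← sub_eq_add_neg]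
    change α u * A v - wedgeCLM α k (contractCLM u k A) v = _
    rw [wedgeCLM_apply]
    rfl
  rw [h, contractCLM_apply, wedgeCLM_apply, Fin.sum_univ_succ]
  congr 1
  · simp [Fin.removeNth_zero]
  · refine Finset.sum_congr rfl fun i _ => ?_
    have : i.succ.removeNth (Matrix.vecCons u v) = Matrix.vecCons u (i.removeNth v) := by
      ext j
      refine Fin.cases ?_ (fun j => ?_) j <;> simp [Fin.removeNth]
    rw [this]
    simp [pow_succ]

theorem contract_wedge_zero {n : ℕ} (α : Space n →L[ℝ] ℝ) (u : Space n) (A : Alt n 0) :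
    contractCLM u 0 (wedgeCLM α 0 A) = α u • A := by
  ext v
  rw [contractCLM_apply, wedgeCLM_apply]
  simp

theorem sum_wedge_contract {n k : ℕ} (A : Alt n (k + 1)) :
    ∑ a, wedgeCLM (dx a) k (contractCLM (basisVec a) k A) = ((k : ℝ) + 1) • A := by
  have h := ContinuousAlternatingMap.alternatizeUncurryFin_curryLeft A
  have h2 : A.curryLeft = ∑ a, (dx a).smulRight (A.curryLeft (basisVec a)) := by
    ext x : 1
    conv_lhs => rw [← (EuclideanSpace.basisFun (Fin n ⊕ Fin n) ℝ).sum_repr x]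
    rw [map_sum, sum_apply]
    refine Finset.sum_congr rfl fun a _ => ?_
    simp [dx, basisVec]
  rw [h2, ← ContinuousAlternatingMap.alternatizeUncurryFinCLM_apply, map_sum] at h
  have h3 : ((k : ℝ) + 1) • A = (k + 1) • A := by
    rw [← Nat.cast_smul_eq_nsmul ℝ]; push_cast; rfl
  rw [h3, ← h]
  rfl

@[simp] theorem wedgeCoord_zero {n : ℕ} (a : Fin n ⊕ Fin n) (A : Form n) (x : Space n) :
    (wedgeCoord a A).1 0 x = 0 := rfl

@[simp] theorem wedgeCoord_succ {n : ℕ} (a : Fin n ⊕ Fin n) (A : Form n) (k : ℕ) (x : Space n) :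
    (wedgeCoord a A).1 (k + 1) x = wedgeCLM (dx a) k (A.1 k x) := rfl

@[simp] theorem contractCoord_apply {n : ℕ} (a : Fin n ⊕ Fin n) (A : Form n) (k : ℕ)
    (x : Space n) :
    (contractCoord a A).1 k x = contractCLM (basisVec a) k (A.1 (k + 1) x) := rfl

theorem contract_wedge_coord {n : ℕ} (a b : Fin n ⊕ Fin n) :
    contractCoord a * wedgeCoord b =
      (if a = b then 1 else 0) - wedgeCoord b * contractCoord a := by
  have hd : (dx b) (basisVec a) = if a = b then (1 : ℝ) else 0 := by
    simp [dx, basisVec, eq_comm]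
  refine LinearMap.ext fun A => Form.ext fun k x => ?_
  rcases k with _ | k
  · simp [contract_wedge_zero, hd]
    split_ifs <;> simp
  · simp [contract_wedge, hd]
    split_ifs <;> simp

theorem number_apply {n k : ℕ} {A : Form n} (hA : A ∈ homog n k) :
    (∑ a, wedgeCoord a * contractCoord a) A = (k : ℝ) • A := by
  have happ : ∀ j x, ((∑ a, wedgeCoord a * contractCoord a) A).1 j x =
      ∑ a, (wedgeCoord a (contractCoord a A)).1 j x := fun j x => by
    simp [LinearMap.sum_apply]
  refine Form.ext fun j x => ?_
  rw [happ]
  rcases j with _ | j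
  · by_cases hk : k = 0
    · simp [hk]
    · simp [hA 0 (Ne.symm hk)]
  · by_cases hk : j + 1 = k
    · subst hk
      simpa using sum_wedge_contract (A.1 (j + 1) x)
    · simp [hA _ hk]

theorem comm_summand {R : Type*} [Ring R] {p q x y δ : R} (hqx : q * x = δ - x * q)
    (hqy : q * y = -(y * q)) (hpx : p * x = -(x * p)) (hpy : p * y = δ - y * p)
    (hδp : p * δ = δ * p) (hδx : x * δ = δ * x) (hδ : δ * δ = δ) :
    (p * q) * (x * y) = (x * y) * (p * q) + δ * (1 - (x * q + y * p)) := by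
  calc (p * q) * (x * y) = p * (q * x) * y := by noncomm_ring
    _ = p * δ * y - (p * x) * (q * y) := by rw [hqx]; noncomm_ring
    _ = δ * (p * y) - x * (p * y) * q := by rw [hpx, hqy, hδp]; noncomm_ring
    _ = δ * δ - δ * (y * p) - x * δ * q + x * y * (p * q) := by rw [hpy]; noncomm_ring
    _ = _ := by rw [hδ, hδx]; noncomm_ring

/-- `[Λ, L] = H`, where `H` acts on forms of degree `k` as `n - k`. -/
theorem Lam_L (n : ℕ) : Lam n * L n = L n * Lam n +
    ((n : Module.End ℝ (Form n)) - ∑ a, wedgeCoord a * contractCoord a) := by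
  have key : ∀ j i : Fin n,
      (contractCoord (Sum.inr j) * contractCoord (Sum.inl j)) *
        (wedgeCoord (Sum.inl i) * wedgeCoord (Sum.inr i)) =
      (wedgeCoord (Sum.inl i) * wedgeCoord (Sum.inr i)) *
        (contractCoord (Sum.inr j) * contractCoord (Sum.inl j)) +
      if j = i then 1 - (wedgeCoord (Sum.inl i) * contractCoord (Sum.inl i) +
        wedgeCoord (Sum.inr i) * contractCoord (Sum.inr i)) else 0 := fun j i => by
    have h := comm_summand (R := Module.End ℝ (Form n)) (δ := if j = i then 1 else 0)
      (by simpa using contract_wedge_coord (Sum.inl j) (Sum.inl i))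
      (by simpa using contract_wedge_coord (Sum.inl j) (Sum.inr i))
      (by simpa using contract_wedge_coord (Sum.inr j) (Sum.inl i))
      (by simpa using contract_wedge_coord (Sum.inr j) (Sum.inr i))
      (by split_ifs <;> simp) (by split_ifs <;> simp) (by split_ifs <;> simp)
    rw [h]
    by_cases hji : j = i
    · subst hji; simp
    · simp [hji]
  rw [Lam, L, Finset.sum_mul_sum, Finset.sum_mul_sum]
  simp only [key, Finset.sum_add_distrib]
  rw [Finset.sum_comm]
  congr 1
  simp [Finset.sum_sub_distrib, Finset.sum_add_distrib]

theorem wedgeCoord_mem {n k : ℕ} (a : Fin n ⊕ Fin n) {A : Form n} (hA : A ∈ homog n k) :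
    wedgeCoord a A ∈ homog n (k + 1) := fun j hj => by
  funext x
  rcases j with _ | j
  · rfl
  · simp [hA j (by omega)]

theorem contractCoord_mem {n k : ℕ} (a : Fin n ⊕ Fin n) {A : Form n} (hA : A ∈ homog n (k + 1)) :
    contractCoord a A ∈ homog n k := fun j hj => by
  funext x
  simp [hA (j + 1) (by omega)]

theorem contractCoord_zero {n : ℕ} (a : Fin n ⊕ Fin n) {A : Form n} (hA : A ∈ homog n 0) :
    contractCoord a A = 0 := by
  ext1 j x
  simp [hA (j + 1) (by omega)]

theorem L_mem {n k : ℕ} {A : Form n} (hA : A ∈ homog n k) : L n A ∈ homog n (k + 2) := by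
  rw [L, LinearMap.sum_apply]
  exact Submodule.sum_mem _ fun i _ => wedgeCoord_mem _ (wedgeCoord_mem _ hA)

theorem Lam_mem {n k : ℕ} {A : Form n} (hA : A ∈ homog n (k + 2)) : Lam n A ∈ homog n k := by
  rw [Lam, LinearMap.sum_apply]
  exact Submodule.sum_mem _ fun i _ => contractCoord_mem _ (contractCoord_mem _ hA)

theorem Lam_eq_zero {n k : ℕ} (hk : k < 2) {A : Form n} (hA : A ∈ homog n k) : Lam n A = 0 := by
  rw [Lam, LinearMap.sum_apply]
  refine Finset.sum_eq_zero fun i _ => ?_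
  obtain rfl | rfl : k = 0 ∨ k = 1 := by omega
  · simp [contractCoord_zero _ hA]
  · simp [contractCoord_zero _ (contractCoord_mem (Sum.inl i) hA)]

theorem comp_eq_zero {n k : ℕ} (hk : 2 * n < k) (A : Form n) : A.1 k = 0 := by
  funext x
  ext v
  refine (A.1 k x).toAlternatingMap.map_linearDependent v fun hv => ?_
  have := hv.fintype_card_le_finrank
  simp at this
  omega

/-- The forms of weight `w`, i.e. of degree `n - w`. -/
def weight (n : ℕ) (w : ℤ) : Submodule ℝ (Form n) :=
  if w ≤ n then homog n (n - w).toNat else ⊥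

theorem mem_weight {n : ℕ} {w : ℤ} {A : Form n} :
    A ∈ weight n w ↔ ∀ j : ℕ, (j : ℤ) ≠ n - w → A.1 j = 0 := by
  unfold weight
  split_ifs with h
  · refine forall_congr' fun j => ?_
    have : j ≠ (n - w).toNat ↔ (j : ℤ) ≠ n - w := by omega
    rw [this]
  · rw [Submodule.mem_bot]
    constructor
    · rintro rfl j _; rfl
    · exact fun hA => Form.ext fun j x => by rw [hA j (by omega)]; rfl

theorem slTwoData (n : ℕ) : SlTwoData (L n) (Lam n) (weight n) n where
  comm w A hA := by
    by_cases h : w ≤ n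
    · rw [weight, if_pos h] at hA
      have h1 := LinearMap.congr_fun (Lam_L n) A
      rw [LinearMap.add_apply, LinearMap.sub_apply, number_apply hA] at h1
      change Lam n (L n A) = L n (Lam n A) + _ at h1
      rw [h1]
      have h2 : ((n : Module.End ℝ (Form n))) A = (n : ℝ) • A := by
        rw [Module.End.natCast_apply, Nat.cast_smul_eq_nsmul]
      have h3 : (((n - w).toNat : ℕ) : ℝ) = n - w := by
        have : (((n - w).toNat : ℤ)) = n - w := Int.toNat_of_nonneg (by omega)
        exact_mod_cast congrArg (Int.cast : ℤ → ℝ) this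
      rw [h2, h3]
      module
    · rw [weight, if_neg h, Submodule.mem_bot] at hA
      simp [hA]
  lower w A hA := by
    by_cases h : w ≤ n
    · rw [weight, if_pos h] at hA
      have := L_mem hA
      rw [weight, if_pos (by omega)]
      convert this using 2
      omega
    · rw [weight, if_neg h, Submodule.mem_bot] at hA
      simp [hA]
  raise w A hA := by
    by_cases h : w ≤ n
    · rw [weight, if_pos h] at hA
      by_cases h2 : w + 2 ≤ n
      · rw [weight, if_pos h2]
        refine Lam_mem ?_
        convert hA using 2
        omega
      · rw [Lam_eq_zero (by omega) hA]
        exact Submodule.zero_mem _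
    · rw [weight, if_neg h, Submodule.mem_bot] at hA
      simp [hA]
  bound w hw := by
    refine (Submodule.eq_bot_iff _).2 fun A hA => Form.ext fun j x => ?_
    rw [mem_weight] at hA
    by_cases hj : (j : ℤ) = n - w
    · rw [comp_eq_zero (by
        rcases abs_cases w with h | h <;> omega)]
      rfl
    · rw [hA j hj]; rfl

/-- The forms `B`, not necessarily homogeneous, which are primitive (`Λ B = 0`) and have components
in the degrees `s ≤ n - r` only.  On this space `L^r` is injective. -/
def primitive (n r : ℕ) : Submodule ℝ (Form n) where
  carrier := {B | Lam n B = 0 ∧ ∀ s, n < r + s → B.1 s = 0}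
  add_mem' := fun {A B} hA hB => ⟨by rw [map_add, hA.1, hB.1, add_zero], fun s hs => by
    simp [hA.2 s hs, hB.2 s hs]⟩
  zero_mem' := ⟨map_zero _, fun _ _ => rfl⟩
  smul_mem' := fun c A hA => ⟨by rw [map_smul, hA.1, smul_zero], fun s hs => by
    simp [hA.2 s hs]⟩

/-- The sum `∑ r, L^r B_r` of a family of primitive forms. -/
def lefschetzSum (n : ℕ) : (∀ r, primitive n r) →ₗ[ℝ] Form n :=
  ∑ r ∈ Finset.range (n + 1), (L n ^ r) ∘ₗ (primitive n r).subtype ∘ₗ LinearMap.proj r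

theorem lefschetzSum_apply {n : ℕ} (b : ∀ r, primitive n r) :
    lefschetzSum n b = ∑ r ∈ Finset.range (n + 1), (L n ^ r) (b r).1 := by
  simp [lefschetzSum, LinearMap.sum_apply]

theorem degPart_mem {n : ℕ} (k : ℕ) (A : Form n) : degPart n k A ∈ homog n k := fun j hj => by
  simp [degPart, hj]

theorem sum_degPart {n : ℕ} (A : Form n) :
    ∑ k ∈ Finset.range (2 * n + 1), degPart n k A = A := by
  ext1 j x
  rw [Form.sum_val, Finset.sum_apply, Finset.sum_apply]
  by_cases hj : j < 2 * n + 1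
  · rw [Finset.sum_eq_single j]
    · simp [degPart]
    · intro k _ hk; simp [degPart, hk.symm]
    · intro h; simp at h; omega
  · rw [comp_eq_zero (by omega) A]
    refine Finset.sum_eq_zero fun k hk => ?_
    rw [comp_eq_zero (by omega)]; rfl

theorem Lam_degPart {n : ℕ} (k : ℕ) (A : Form n) :
    Lam n (degPart n (k + 2) A) = degPart n k (Lam n A) := by
  ext1 j x
  by_cases hj : j = k
  · subst hj
    simp [Lam, degPart, LinearMap.sum_apply]
  · rw [Lam_mem (degPart_mem (k + 2) A) j hj, degPart_mem k _ j hj]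

theorem degPart_primitive {n r : ℕ} (k : ℕ) {B : Form n} (hB : B ∈ primitive n r) :
    Lam n (degPart n k B) = 0 := by
  rcases k with _ | _ | k
  · exact Lam_eq_zero (by omega) (degPart_mem 0 B)
  · exact Lam_eq_zero (by omega) (degPart_mem 1 B)
  · rw [Lam_degPart, hB.1, map_zero]

theorem homog_weight {n k : ℕ} : homog n k = weight n (n - k) := by
  rw [weight, if_pos (by omega)]
  congr 1
  omega

theorem Lam_pow_L_pow {n m r : ℕ} (hr : r < m) {B : Form n} (hB : B ∈ primitive n r) :
    (Lam n ^ m) ((L n ^ r) B) = 0 := by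
  rw [← sum_degPart B, map_sum, map_sum]
  refine Finset.sum_eq_zero fun k _ => ?_
  exact (slTwoData n).pow_raise_pow_eq_zero r m hr
    (by rw [← homog_weight]; exact degPart_mem k B) (degPart_primitive k hB)

theorem eq_zero_of_Lam_pow_L_pow {n r : ℕ} {B : Form n} (hB : B ∈ primitive n r)
    (h : (Lam n ^ r) ((L n ^ r) B) = 0) : B = 0 := by
  have hc : ∀ k, ∃ c : ℝ, c ≠ 0 ∧
      (Lam n ^ r) ((L n ^ r) (degPart n k B)) = c • degPart n k B := fun k => by
    by_cases hk : n < r + k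
    · refine ⟨1, one_ne_zero, ?_⟩
      have h0 : degPart n k B = 0 := by
        ext1 j x
        by_cases hj : j = k
        · subst hj; simp [degPart, hB.2 j hk]
        · rw [degPart_mem k B j hj]; rfl
      simp [h0]
    · obtain ⟨c, h0, h1⟩ := (slTwoData n).pow_raise_pow r 0 (w := n - k) (by push_cast; omega)
      refine ⟨c, h0, ?_⟩
      simpa using h1 (degPart n k B) (by rw [← homog_weight]; exact degPart_mem k B)
        (degPart_primitive k hB)
  choose c hc0 hc1 using hc
  rw [← sum_degPart B, map_sum, map_sum] at h
  simp only [hc1] at h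
  ext1 j x
  by_cases hj : j < 2 * n + 1
  · have h2 := congrArg (fun A : Form n => A.1 j x) h
    simp only [Form.sum_val, Finset.sum_apply] at h2
    rw [Finset.sum_eq_single j] at h2
    · simpa [degPart, hc0 j] using h2
    · intro k _ hk; simp [degPart, hk.symm]
    · intro h; simp at h; omega
  · rw [comp_eq_zero (by omega) B]; rfl

theorem lefschetzSum_injective (n : ℕ) : Function.Injective (lefschetzSum n) := by
  rw [injective_iff_map_eq_zero]
  intro b hb
  rw [lefschetzSum_apply] at hb
  have key : ∀ N ≤ n + 1, ∑ r ∈ Finset.range N, (L n ^ r) (b r).1 = 0 →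
      ∀ r < N, (b r).1 = 0 := by
    intro N
    induction N with
    | zero => intro _ _ r hr; omega
    | succ N ih =>
      intro hN hsum r hr
      rw [Finset.sum_range_succ] at hsum
      have h1 := congrArg (Lam n ^ N) hsum
      rw [map_add, map_sum, map_zero, Finset.sum_eq_zero (fun r hr =>
        Lam_pow_L_pow (Finset.mem_range.1 hr) (b r).2), zero_add] at h1
      have h2 := eq_zero_of_Lam_pow_L_pow (b N).2 h1
      rcases Nat.lt_succ_iff_lt_or_eq.1 hr with h | rfl
      · refine ih (by omega) ?_ r h
        simpa [h2] using hsum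
      · exact h2
  funext r
  apply Subtype.ext
  by_cases hr : r < n + 1
  · exact key _ le_rfl hb r hr
  · exact Form.ext fun j x => by rw [(b r).2.2 j (by omega)]; rfl

theorem lefschetzSum_surjective (n : ℕ) : Function.Surjective (lefschetzSum n) := by
  intro A
  suffices h : A ∈ LinearMap.range (lefschetzSum n) from h
  rw [← sum_degPart A]
  refine Submodule.sum_mem _ fun k _ => ?_
  refine (slTwoData n).mem_span _ (fun m w hmw u hu hLam => ?_) (n - k)
    (by rw [← homog_weight]; exact degPart_mem k A)
  rw [mem_weight] at hu
  by_cases hw : w ≤ n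
  · refine ⟨Pi.single m ⟨u, hLam, fun s hs => hu s (by omega)⟩, ?_⟩
    rw [lefschetzSum_apply, Finset.sum_eq_single m]
    · simp
    · intro r _ hr; simp [hr]
    · intro h; simp at h; omega
  · have : u = 0 := Form.ext fun j x => by rw [hu j (by omega)]; rfl
    rw [this, map_zero]
    exact Submodule.zero_mem _

/-- The Lefschetz decomposition: every form `A` can be written in a unique way as
`A = ∑ r, L^r B_r`, where `B_r` is primitive with components in the degrees `s ≤ n - r` only. -/
def lefschetzEquiv (n : ℕ) : (∀ r, primitive n r) ≃ₗ[ℝ] Form n :=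
  LinearEquiv.ofBijective (lefschetzSum n) ⟨lefschetzSum_injective n, lefschetzSum_surjective n⟩

/-- The primitive form `B_r` in the Lefschetz decomposition `A = ∑ r, L^r B_r`. -/
def lefschetzPart (n r : ℕ) : Module.End ℝ (Form n) :=
  (primitive n r).subtype ∘ₗ LinearMap.proj r ∘ₗ (lefschetzEquiv n).symm.toLinearMap

theorem lefschetzPart_mem {n : ℕ} (r : ℕ) (A : Form n) : lefschetzPart n r A ∈ primitive n r :=
  ((lefschetzEquiv n).symm A r).2

theorem sum_lefschetzPart {n : ℕ} (A : Form n) :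
    ∑ r ∈ Finset.range (n + 1), (L n ^ r) (lefschetzPart n r A) = A := by
  rw [← (lefschetzEquiv n).apply_symm_apply A]
  refine Eq.trans ?_ (lefschetzSum_apply ((lefschetzEquiv n).symm A)).symm
  simp [lefschetzPart]

theorem lefschetzPart_unique {n : ℕ} (b : ∀ r, primitive n r) (r : ℕ) :
    lefschetzPart n r (∑ i ∈ Finset.range (n + 1), (L n ^ i) (b i).1) = (b r).1 := by
  have h : lefschetzEquiv n b = ∑ i ∈ Finset.range (n + 1), (L n ^ i) (b i).1 :=
    lefschetzSum_apply b
  rw [← h]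
  simp [lefschetzPart]

/-! ### Operators defined by the Lefschetz decomposition -/

/-- The projection `Π^p (∑ r, L^r B_r) = ∑ r ≤ p, L^r B_r`. -/
def filterProj (n p : ℕ) : Module.End ℝ (Form n) :=
  ∑ r ∈ Finset.range (p + 1), L n ^ r * lefschetzPart n r

/-- The reflection operator `*_r`, with `*_r (L^r B_s) = L^{n-r-s} B_s` for a primitive form `B_s`
of degree `s ≤ n - r`. -/
def starR (n : ℕ) : Module.End ℝ (Form n) :=
  ∑ r ∈ Finset.range (n + 1), ∑ s ∈ Finset.range (n + 1 - r),
    L n ^ (n - r - s) * degPart n s * lefschetzPart n r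

/-- The operator `∂_+` of the decomposition `d = ∂_+ + L ∂_-`: on `L^r B_s`, with `B_s` primitive of
degree `s`, it is the component of `d (L^r B_s)` in `L^r 𝓑^{s+1}`. -/
def delPlus (n : ℕ) : Module.End ℝ (Form n) :=
  ∑ r ∈ Finset.range (n + 1),
    (L n ^ r * lefschetzPart n r) * d n * (L n ^ r * lefschetzPart n r)

/-- The operator `∂_-` of the decomposition `d = ∂_+ + L ∂_-`: on `L^r B_s`, with `B_s` primitive of
degree `s`, it is `L^r B'_{s-1}`, where `L^{r+1} B'_{s-1}` is the component of `d (L^r B_s)` in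
`L^{r+1} 𝓑^{s-1}`. -/
def delMinus (n : ℕ) : Module.End ℝ (Form n) :=
  ∑ r ∈ Finset.range (n + 1),
    (L n ^ r * lefschetzPart n (r + 1)) * d n * (L n ^ r * lefschetzPart n r)

/-- `d_+ = Π^p ∘ d`. -/
def dPlus (n p : ℕ) : Module.End ℝ (Form n) := filterProj n p * d n

/-- `d_- = *_r d *_r`. -/
def dMinus (n : ℕ) : Module.End ℝ (Form n) := starR n * d n * starR n

/-! ### Filtered forms and filtered cohomologies

The elliptic complex of filtration degree `p` is
`F^p 𝒜^0 → F^p 𝒜^1 → ⋯ → F^p 𝒜^{n+p} → F^p 𝒜^{n+p} → F^p 𝒜^{n+p-1} → ⋯ → F^p 𝒜^0`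
with the differentials `d_+` in the first half, `∂_+ ∂_-` in the middle and `d_-` in the second
half. -/

/-- The space `F^p 𝒜^k` of `p`-filtered forms of degree `k`: `Λ^{p+1} A = 0`. -/
def filtered (n p k : ℕ) : Submodule ℝ (Form n) :=
  homog n k ⊓ LinearMap.ker (Lam n ^ (p + 1))

/-- The cocycles of degree `k ≤ n + p` in the first half of the complex. -/
def cocyclesPlus (n p k : ℕ) : Submodule ℝ (Form n) :=
  filtered n p k ⊓
    (if k < n + p then LinearMap.ker (dPlus n p) else LinearMap.ker (delPlus n * delMinus n))

/-- The coboundaries of degree `k ≤ n + p` in the first half of the complex. -/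
def coboundariesPlus (n p : ℕ) : ℕ → Submodule ℝ (Form n)
  | 0 => ⊥
  | k + 1 => (filtered n p k).map (dPlus n p)

/-- The cocycles of degree `k ≤ n + p` in the second half of the complex. -/
def cocyclesMinus (n p k : ℕ) : Submodule ℝ (Form n) :=
  filtered n p k ⊓ LinearMap.ker (dMinus n)

/-- The coboundaries of degree `k ≤ n + p` in the second half of the complex. -/
def coboundariesMinus (n p k : ℕ) : Submodule ℝ (Form n) :=
  if k < n + p then (filtered n p (k + 1)).map (dMinus n)
  else (filtered n p k).map (delPlus n * delMinus n)

/-- The filtered cohomology `F^p H_+^k (U)`, for `0 ≤ k ≤ n + p`. -/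
abbrev HPlus (n p k : ℕ) : Type :=
  cocyclesPlus n p k ⧸ (coboundariesPlus n p k).submoduleOf (cocyclesPlus n p k)

/-- The filtered cohomology `F^p H_-^k (U)`, for `0 ≤ k ≤ n + p`. -/
abbrev HMinus (n p k : ℕ) : Type :=
  cocyclesMinus n p k ⧸ (coboundariesMinus n p k).submoduleOf (cocyclesMinus n p k)

/-- The index of the complex, the alternating sum of the dimensions of its cohomologies.  In the
complex the term of `F^p H_+^k` is at the place `k` and that of `F^p H_-^k` at the place
`2n + 2p + 1 - k`. -/
def index (n p : ℕ) : ℤ :=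
  ∑ k ∈ Finset.range (n + p + 1), (-1 : ℤ) ^ k * (Module.finrank ℝ (HPlus n p k) : ℤ) +
  ∑ k ∈ Finset.range (n + p + 1),
    (-1 : ℤ) ^ (2 * n + 2 * p + 1 - k) * (Module.finrank ℝ (HMinus n p k) : ℤ)

end FilteredForms

end

/-!
Everything reduces to the Poincaré lemma for `d` on the disk. Since `Π^p` annihilates exactly the
multiples of `L^{p+1}`, a form `A ∈ F^p 𝒜^k` is a cocycle of the first half if and only if
`d A = L^{p+1} C` with `C` closed: for `k < n + p` because `L^{p+1}` is injective in the degree of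
`d C`, and for `k = n + p` because `∂_+ ∂_- A = L^p (d C)`. It is a coboundary if and only if `C`
can be chosen exact. As `C` has degree `k - 2p - 1`, it is exact unless `k = 2p + 1`, where it is
a constant; this constant and the constant functions in degree `0` give the only classes.

In the second half, `A` is a cocycle if and only if `*_r A` is closed, hence `*_r A = d E` unless
`*_r A` is a function, that is, `k = 2n`. As `A` is filtered, `L^{p+1} (*_r A) = 0`, so
`L^{p+1} E` is closed and hence equal to `d F`; subtracting an exact form from `E` makes `F`
filtered. If `k < n + p` then `F = 0` and `A = d_- (*_r E)`, while for `k = n + p` one finds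
`A = ∂_+ ∂_- F`.
-/

noncomputable section

section RadialIntegral

variable {V W Z : Type*} [NormedAddCommGroup V] [NormedSpace ℝ V] [NormedAddCommGroup W]
  [NormedSpace ℝ W] [NormedAddCommGroup Z] [NormedSpace ℝ Z] {s : Set V} {F : V → W} {x : V}

/-- The weighted average `∫₀¹ t^m F(t x) dt` of `F` over the segment from the origin to `x`. -/
def radialIntegral (m : ℕ) (F : V → W) (x : V) : W := ∫ t in (0 : ℝ)..1, t ^ m • F (t • x)

theorem uIoc_zero_one_subset : Set.uIoc (0 : ℝ) 1 ⊆ Set.Icc 0 1 := by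
  rw [Set.uIoc_of_le zero_le_one]
  exact Set.Ioc_subset_Icc_self

theorem norm_pow_smul_le {t : ℝ} (ht : t ∈ Set.Icc (0 : ℝ) 1) (m : ℕ) (w : W) :
    ‖t ^ m • w‖ ≤ ‖w‖ := by
  rw [norm_smul, norm_pow, Real.norm_of_nonneg ht.1]
  exact mul_le_of_le_one_left (norm_nonneg w) (pow_le_one₀ ht.1 ht.2)

theorem continuousOn_radial (hs : StarConvex ℝ 0 s) (hF : ContinuousOn F s) (m : ℕ) (hx : x ∈ s) :
    ContinuousOn (fun t : ℝ => t ^ m • F (t • x)) (Set.uIcc 0 1) := by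
  rw [Set.uIcc_of_le zero_le_one]
  exact (continuous_pow m).continuousOn.smul
    (hF.comp (by fun_prop) fun t ht => hs.smul_mem hx ht.1 ht.2)

theorem radialIntegral_clm_comp [CompleteSpace W] [CompleteSpace Z] (hs : StarConvex ℝ 0 s)
    (hF : ContinuousOn F s) (T : W →L[ℝ] Z) (m : ℕ) (hx : x ∈ s) :
    radialIntegral m (fun y => T (F y)) x = T (radialIntegral m F x) := by
  simp only [radialIntegral, ← map_smul]
  exact T.intervalIntegral_comp_comm (continuousOn_radial hs hF m hx).intervalIntegrable

/-- The fundamental theorem of calculus for `t ↦ t^{m+1} F(t x)` on `[0, 1]`. -/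
theorem radialIntegral_add_radialIntegral_fderiv [CompleteSpace W] (hso : IsOpen s)
    (hs : StarConvex ℝ 0 s) (hF : ContDiffOn ℝ 1 F s) (m : ℕ) (hx : x ∈ s) :
    ((m : ℝ) + 1) • radialIntegral m F x + radialIntegral (m + 1) (fderiv ℝ F) x x = F x := by
  have hF' : ContinuousOn (fderiv ℝ F) s := hF.continuousOn_fderiv_of_isOpen hso le_rfl
  have h₁ : ContinuousOn (fun t : ℝ => ((m : ℝ) + 1) • t ^ m • F (t • x)) (Set.uIcc 0 1) :=
    (continuousOn_radial hs hF.continuousOn m hx).const_smul ((m : ℝ) + 1)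
  have h₂ : ContinuousOn (fun t : ℝ => t ^ (m + 1) • fderiv ℝ F (t • x) x) (Set.uIcc 0 1) :=
    continuousOn_radial hs (hF'.clm_apply continuousOn_const) (m + 1) hx
  have hderiv : ∀ t ∈ Set.uIcc (0 : ℝ) 1, HasDerivAt (fun t : ℝ => t ^ (m + 1) • F (t • x))
      (((m : ℝ) + 1) • t ^ m • F (t • x) + t ^ (m + 1) • fderiv ℝ F (t • x) x) t := by
    intro t ht
    rw [Set.uIcc_of_le zero_le_one] at ht
    have hFt : HasFDerivAt F (fderiv ℝ F (t • x)) (t • x) :=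
      ((hF.contDiffAt (hso.mem_nhds (hs.smul_mem hx ht.1 ht.2))).differentiableAt
        one_ne_zero).hasFDerivAt
    convert (hasDerivAt_pow (m + 1) t).smul
      (hFt.comp_hasDerivAt t ((hasDerivAt_id t).smul_const x)) using 1
    · rfl
    · simp [smul_smul, add_comm]
  rw [← ContinuousLinearMap.apply_apply (𝕜 := ℝ) x (radialIntegral _ _ x),
    ← radialIntegral_clm_comp hs hF' _ _ hx]
  simp only [radialIntegral, ContinuousLinearMap.apply_apply]
  rw [← intervalIntegral.integral_smul,
    ← intervalIntegral.integral_add h₁.intervalIntegrable h₂.intervalIntegrable,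
    intervalIntegral.integral_eq_sub_of_hasDerivAt hderiv (h₁.add h₂).intervalIntegrable]
  simp

theorem eventually_forall_norm_smul_lt {E : Type*} [SeminormedAddCommGroup E] {F : V → E}
    (hso : IsOpen s) (hs : StarConvex ℝ 0 s) (hF : ContinuousOn F s) (hx : x ∈ s) :
    ∃ C, ∀ᶠ y in nhds x, ∀ t ∈ Set.Icc (0 : ℝ) 1, t • y ∈ s ∧ ‖F (t • y)‖ < C := by
  obtain ⟨C, hC⟩ := isCompact_Icc.exists_bound_of_continuousOn (s := Set.Icc (0 : ℝ) 1)
    (hF.comp (by fun_prop : ContinuousOn (fun t : ℝ => t • x) _)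
      fun t ht => hs.smul_mem hx ht.1 ht.2)
  refine ⟨C + 1, isCompact_Icc.eventually_forall_of_forall_eventually fun t ht => ?_⟩
  have hts : s ∈ nhds (t • x) := hso.mem_nhds (hs.smul_mem hx ht.1 ht.2)
  have hlim : Filter.Tendsto (fun z : V × ℝ => z.2 • z.1) (nhds (x, t)) (nhds (t • x)) :=
    (continuous_snd.smul continuous_fst).tendsto (x, t)
  exact hlim.eventually ((Filter.eventually_mem_set.2 hts).and
    ((hF.continuousAt hts).norm.eventually_lt continuousAt_const
      ((hC t ht).trans_lt (lt_add_one C))))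

theorem continuousAt_radialIntegral (hso : IsOpen s) (hs : StarConvex ℝ 0 s)
    (hF : ContinuousOn F s) (m : ℕ) (hx : x ∈ s) : ContinuousAt (radialIntegral m F) x := by
  obtain ⟨C, hC⟩ := eventually_forall_norm_smul_lt hso hs hF hx
  refine intervalIntegral.continuousAt_of_dominated_interval (bound := fun _ => C) ?_ ?_
    intervalIntegrable_const (Filter.Eventually.of_forall fun t ht => ?_)
  · filter_upwards [hso.mem_nhds hx] with y hy
    exact (continuousOn_radial hs hF m hy).intervalIntegrable.def'.aestronglyMeasurable
  · filter_upwards [hC] with y hy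
    refine Filter.Eventually.of_forall fun t ht => ?_
    have ht := uIoc_zero_one_subset ht
    exact (norm_pow_smul_le ht m _).trans (hy t ht).2.le
  · have ht := uIoc_zero_one_subset ht
    exact ((hF.continuousAt (hso.mem_nhds (hs.smul_mem hx ht.1 ht.2))).comp
      (continuous_const_smul t).continuousAt).const_smul (t ^ m)

theorem hasFDerivAt_radialIntegral (hso : IsOpen s) (hs : StarConvex ℝ 0 s)
    (hF : ContDiffOn ℝ 1 F s) (m : ℕ) (hx : x ∈ s) :
    HasFDerivAt (radialIntegral m F) (radialIntegral (m + 1) (fderiv ℝ F) x) x := by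
  have hF' : ContinuousOn (fderiv ℝ F) s := hF.continuousOn_fderiv_of_isOpen hso le_rfl
  obtain ⟨C, hC⟩ := eventually_forall_norm_smul_lt hso hs hF' hx
  refine intervalIntegral.hasFDerivAt_integral_of_dominated_of_fderiv_le
    (F' := fun y t => t ^ (m + 1) • fderiv ℝ F (t • y)) (bound := fun _ => C) hC ?_
    (continuousOn_radial hs hF.continuousOn m hx).intervalIntegrable
    (continuousOn_radial hs hF' (m + 1) hx).intervalIntegrable.def'.aestronglyMeasurable
    (Filter.Eventually.of_forall fun t ht y hy => ?_) intervalIntegrable_const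
    (Filter.Eventually.of_forall fun t ht y hy => ?_)
  · filter_upwards [hso.mem_nhds hx] with y hy
    exact (continuousOn_radial hs hF.continuousOn m hy).intervalIntegrable.def'.aestronglyMeasurable
  · have ht := uIoc_zero_one_subset ht
    exact (norm_pow_smul_le ht (m + 1) _).trans (hy t ht).2.le
  · have hFt : HasFDerivAt F (fderiv ℝ F (t • y)) (t • y) :=
      ((hF.contDiffAt (hso.mem_nhds (hy t (uIoc_zero_one_subset ht)).1)).differentiableAt
        one_ne_zero).hasFDerivAt
    convert (hFt.comp y ((hasFDerivAt_id y).const_smul t)).const_smul (t ^ m) using 1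
    · rfl
    rw [ContinuousLinearMap.comp_smul, ContinuousLinearMap.comp_id, smul_smul, pow_succ]

end RadialIntegral

section ContDiff

universe u

variable {V W : Type u} [NormedAddCommGroup V] [NormedSpace ℝ V] [NormedAddCommGroup W]
  [NormedSpace ℝ W] {s : Set V} {F : V → W}

theorem contDiffOn_radialIntegral (hso : IsOpen s) (hs : StarConvex ℝ 0 s) {N : ℕ}
    (hF : ContDiffOn ℝ N F s) (m : ℕ) : ContDiffOn ℝ N (radialIntegral m F) s := by
  induction N generalizing W m with
  | zero =>
    rw [Nat.cast_zero, contDiffOn_zero] at hF ⊢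
    exact fun x hx => (continuousAt_radialIntegral hso hs hF m hx).continuousWithinAt
  | succ N ih =>
    have hF₁ : ContDiffOn ℝ 1 F s := hF.of_le (by simp)
    rw [Nat.cast_succ, contDiffOn_succ_iff_fderiv_of_isOpen hso]
    refine ⟨fun x hx => (hasFDerivAt_radialIntegral hso hs hF₁ m
      hx).differentiableAt.differentiableWithinAt, by simp, ?_⟩
    exact (ih (hF.fderiv_of_isOpen hso (by simp)) (m + 1)).congr
      fun x hx => (hasFDerivAt_radialIntegral hso hs hF₁ m hx).fderiv

end ContDiff

section Alternating

open ContinuousAlternatingMap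

variable {E F : Type*} [NormedAddCommGroup E] [NormedSpace ℝ E] [NormedAddCommGroup F]
  [NormedSpace ℝ F] {k : ℕ}

theorem alternatizeUncurryFin_smulRight_comp (α : E →L[ℝ] ℝ) (G : E →L[ℝ] E [⋀^Fin k]→L[ℝ] F) :
    alternatizeUncurryFin (alternatizeUncurryFinCLM ℝ E F ∘L
      ContinuousLinearMap.smulRightL ℝ E (E [⋀^Fin k]→L[ℝ] F) α ∘L G) =
      -alternatizeUncurryFin (α.smulRight (alternatizeUncurryFin G)) := by
  set f₁ := ContinuousLinearMap.smulRightL ℝ E (E [⋀^Fin k]→L[ℝ] F) α ∘L G with hf₁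
  set f₂ : E →L[ℝ] E →L[ℝ] E [⋀^Fin k]→L[ℝ] F := α.smulRight G with hf₂
  have hsymm : alternatizeUncurryFin (alternatizeUncurryFinCLM ℝ E F ∘L (f₁ + f₂)) = 0 :=
    alternatizeUncurryFin_alternatizeUncurryFinCLM_comp_of_symmetric
      fun x y => by simp [hf₁, hf₂, add_comm]
  have hf₂' : alternatizeUncurryFinCLM ℝ E F ∘L f₂ = α.smulRight (alternatizeUncurryFin G) := by
    ext x : 1
    simp [hf₂, ← alternatizeUncurryFinCLM_apply]
  rw [ContinuousLinearMap.comp_add, hf₂', alternatizeUncurryFin_add] at hsymm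
  exact eq_neg_of_add_eq_zero_left hsymm

theorem removeNth_succ_cons {α : Type*} (i : Fin (k + 1)) (u : α) (v : Fin (k + 1) → α) :
    i.succ.removeNth (Matrix.vecCons u v) = Matrix.vecCons u (i.removeNth v) := by
  ext j
  refine Fin.cases ?_ (fun j => ?_) j <;> simp [Fin.removeNth]

/-- Interior multiplication `u ↦ A ↦ ι_u A`, as a continuous bilinear map. -/
def interiorCLM (E F : Type*) [NormedAddCommGroup E] [NormedSpace ℝ E] [NormedAddCommGroup F]
    [NormedSpace ℝ F] (k : ℕ) : E →L[ℝ] (E [⋀^Fin (k + 1)]→L[ℝ] F) →L[ℝ] E [⋀^Fin k]→L[ℝ] F :=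
  (curryLeftLI (𝕜 := ℝ) (E := E) (F := F) (n := k)).toContinuousLinearMap.flip

theorem interiorCLM_alternatizeUncurryFin (u : E) (G : E →L[ℝ] E [⋀^Fin (k + 1)]→L[ℝ] F) :
    interiorCLM E F (k + 1) u (alternatizeUncurryFin G) =
      G u - alternatizeUncurryFin (interiorCLM E F k u ∘L G) := by
  ext v
  change alternatizeUncurryFin G (Matrix.vecCons u v) =
    G u v - alternatizeUncurryFin (interiorCLM E F k u ∘L G) v
  rw [alternatizeUncurryFin_apply, alternatizeUncurryFin_apply, Fin.sum_univ_succ,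
    sub_eq_add_neg, ← Finset.sum_neg_distrib]
  congr 1
  · simp [Fin.removeNth_zero]
  · refine Finset.sum_congr rfl fun i _ => ?_
    rw [removeNth_succ_cons, Fin.val_succ, pow_succ, mul_neg_one, neg_smul]
    rfl

/-- The primitive `ι_x ∫₀¹ t^k A(t x) dt` of a closed form `A` of degree `k + 1`. -/
def conePrimitive (A : E → E [⋀^Fin (k + 1)]→L[ℝ] F) (x : E) : E [⋀^Fin k]→L[ℝ] F :=
  interiorCLM E F k x (radialIntegral k A x)

variable {s : Set E}

theorem extDeriv_conePrimitive [CompleteSpace F] (hso : IsOpen s) (hs : StarConvex ℝ 0 s)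
    {A : E → E [⋀^Fin (k + 1)]→L[ℝ] F} (hA : ContDiffOn ℝ 1 A s)
    (hd : ∀ x ∈ s, extDeriv A x = 0) {x : E} (hx : x ∈ s) :
    extDeriv (conePrimitive A) x = A x := by
  set R := radialIntegral k A x
  set G := radialIntegral (k + 1) (fderiv ℝ A) x with hG
  have hderiv : HasFDerivAt (conePrimitive A) (interiorCLM E F k x ∘L G + R.curryLeft) x :=
    (interiorCLM E F k).hasFDerivAt.clm_apply (hasFDerivAt_radialIntegral hso hs hA k hx)
  have hclosed : alternatizeUncurryFin G = 0 := by
    rw [← alternatizeUncurryFinCLM_apply, hG, ← radialIntegral_clm_comp hs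
      (hA.continuousOn_fderiv_of_isOpen hso le_rfl) (alternatizeUncurryFinCLM ℝ E F) (k + 1) hx]
    refine (intervalIntegral.integral_congr (g := fun _ => 0) fun t ht => ?_).trans (by simp)
    rw [Set.uIcc_of_le zero_le_one] at ht
    change t ^ (k + 1) • extDeriv A (t • x) = 0
    rw [hd _ (hs.smul_mem hx ht.1 ht.2), smul_zero]
  have hinterior : alternatizeUncurryFin (interiorCLM E F k x ∘L G) = G x := by
    have h := interiorCLM_alternatizeUncurryFin x G
    rwa [hclosed, _root_.map_zero, eq_comm, sub_eq_zero, eq_comm] at h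
  rw [extDeriv, hderiv.fderiv, alternatizeUncurryFin_add, hinterior,
    alternatizeUncurryFin_curryLeft, ← Nat.cast_smul_eq_nsmul ℝ, Nat.cast_succ, add_comm (G x)]
  exact radialIntegral_add_radialIntegral_fderiv hso hs hA k hx

end Alternating

section Poincare

universe u

variable {E F : Type u} [NormedAddCommGroup E] [NormedSpace ℝ E] [NormedAddCommGroup F]
  [NormedSpace ℝ F] {k : ℕ} {s : Set E}

theorem contDiffOn_conePrimitive (hso : IsOpen s) (hs : StarConvex ℝ 0 s)
    {A : E → E [⋀^Fin (k + 1)]→L[ℝ] F} (hA : ContDiffOn ℝ ∞ A s) :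
    ContDiffOn ℝ ∞ (conePrimitive A) s :=
  (interiorCLM E F k).contDiff.contDiffOn.clm_apply <|
    contDiffOn_infty.2 fun N => contDiffOn_radialIntegral hso hs (contDiffOn_infty.1 hA N) k

end Poincare

section QuotientRank

variable {R M : Type*} [Ring R] [AddCommGroup M] [Module R M] {S T : Submodule R M}

theorem rank_quotient_submoduleOf_eq_zero [Nontrivial R] (h : T ≤ S) :
    Module.rank R (T ⧸ S.submoduleOf T) = 0 := by
  have : Subsingleton (T ⧸ S.submoduleOf T) :=
    Submodule.Quotient.subsingleton_iff.2 (Submodule.submoduleOf_eq_top.2 h)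
  exact rank_subsingleton' R _

theorem rank_quotient_submoduleOf_eq_one [StrongRankCondition R] (φ : M →ₗ[R] R)
    (hφ : ∀ x ∈ T, x ∈ S ↔ φ x = 0) (h1 : ∃ x ∈ T, φ x = 1) :
    Module.rank R (T ⧸ S.submoduleOf T) = 1 := by
  have hker : LinearMap.ker (φ.domRestrict T) = S.submoduleOf T := by
    ext x
    exact (hφ x x.2).symm
  obtain ⟨x, hx, hφx⟩ := h1
  have hsurj : Function.Surjective (φ.domRestrict T) := fun c =>
    ⟨c • ⟨x, hx⟩, by
      rw [map_smul, LinearMap.domRestrict_apply, hφx, smul_eq_mul, mul_one]⟩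
  have hrank := ((φ.domRestrict T).quotKerEquivOfSurjective hsurj).lift_rank_eq
  rwa [hker, Module.rank_self, Cardinal.lift_one, Cardinal.lift_eq_one] at hrank

theorem finite_of_rank_eq_ite {K V : Type*} [DivisionRing K] [AddCommGroup V] [Module K V]
    {P : Prop} [Decidable P] (h : Module.rank K V = if P then 1 else 0) : Module.Finite K V := by
  rw [← Module.rank_lt_aleph0_iff, h]
  split_ifs
  · exact Cardinal.one_lt_aleph0
  · exact Cardinal.aleph0_pos

end QuotientRank

namespace FilteredForms

variable {n : ℕ}

section Calculus

open ContinuousAlternatingMap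

theorem isOpen_disk (n : ℕ) : IsOpen (disk n) := Metric.isOpen_ball

theorem convex_disk (n : ℕ) : Convex ℝ (disk n) := convex_ball 0 1

theorem zero_mem_disk (n : ℕ) : (0 : Space n) ∈ disk n := Metric.mem_ball_self one_pos

theorem form_ext_disk {A B : Form n} (h : ∀ k, ∀ x ∈ disk n, A.1 k x = B.1 k x) : A = B := by
  ext1 k x
  by_cases hx : x ∈ disk n
  · exact h k x hx
  · rw [(mem_Form.1 A.2 k).2 x hx, (mem_Form.1 B.2 k).2 x hx]

theorem homog_ext {k : ℕ} {A B : Form n} (hA : A ∈ homog n k) (hB : B ∈ homog n k)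
    (h : ∀ x ∈ disk n, A.1 k x = B.1 k x) : A = B := by
  refine form_ext_disk fun j x hx => ?_
  by_cases hj : j = k
  · exact hj ▸ h x hx
  · rw [hA j hj, hB j hj]

theorem contDiffAt_val (A : Form n) (k : ℕ) {x : Space n} (hx : x ∈ disk n) :
    ContDiffAt ℝ ∞ (A.1 k) x :=
  (mem_Form.1 A.2 k).1.contDiffAt ((isOpen_disk n).mem_nhds hx)

theorem d_val_succ (A : Form n) (k : ℕ) {x : Space n} (hx : x ∈ disk n) :
    (d n A).1 (k + 1) x = extDeriv (A.1 k) x :=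
  Set.indicator_of_mem hx _

theorem extDeriv_eq_zero_of_eq_zero {A : Form n} {k : ℕ} (h : A.1 k = 0) (x : Space n) :
    extDeriv (A.1 k) x = 0 := by
  rw [extDeriv, h, fderiv_zero, Pi.zero_apply, ← alternatizeUncurryFinCLM_apply, _root_.map_zero]

theorem d_d (A : Form n) : d n (d n A) = 0 := by
  refine form_ext_disk fun k x hx => ?_
  rcases k with _ | _ | k
  · rfl
  · rw [d_val_succ _ _ hx, extDeriv_eq_zero_of_eq_zero rfl]
    rfl
  · have h : (d n A).1 (k + 1) =ᶠ[nhds x] extDeriv (A.1 k) :=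
      (Set.eqOn_indicator).eventuallyEq_of_mem ((isOpen_disk n).mem_nhds hx)
    rw [d_val_succ _ _ hx, h.extDeriv_eq]
    exact extDeriv_extDeriv_apply (contDiffAt_val A k hx)
      (by simpa using WithTop.coe_le_coe.2 (le_top (a := (2 : ℕ∞))))

theorem d_mem_homog {k : ℕ} {A : Form n} (hA : A ∈ homog n k) : d n A ∈ homog n (k + 1) := by
  rintro (_ | j) hj
  · rfl
  · funext x
    by_cases hx : x ∈ disk n
    · rw [d_val_succ _ _ hx, extDeriv_eq_zero_of_eq_zero (hA j (by omega))]
      rfl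
    · exact (mem_Form.1 (d n A).2 (j + 1)).2 x hx

theorem d_wedgeCoord (a : Fin n ⊕ Fin n) (A : Form n) :
    d n (wedgeCoord a A) = -wedgeCoord a (d n A) := by
  refine form_ext_disk fun k x hx => ?_
  rcases k with _ | _ | k
  · rw [Form.neg_val, Pi.neg_apply, Pi.neg_apply, wedgeCoord_zero, neg_zero]
    rfl
  · rw [d_val_succ _ _ hx, extDeriv_eq_zero_of_eq_zero (funext (wedgeCoord_zero a A)),
      Form.neg_val, Pi.neg_apply, Pi.neg_apply, wedgeCoord_succ]
    change 0 = -wedgeCLM (dx a) 0 0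
    rw [_root_.map_zero, neg_zero]
  · have hfderiv : HasFDerivAt ((wedgeCoord a A).1 (k + 1))
        (wedgeCLM (dx a) k ∘L fderiv ℝ (A.1 k) x) x :=
      (wedgeCLM (dx a) k).hasFDerivAt.comp x
        ((contDiffAt_val A k hx).differentiableAt (by simp)).hasFDerivAt
    rw [d_val_succ _ _ hx, Form.neg_val, Pi.neg_apply, Pi.neg_apply, wedgeCoord_succ,
      d_val_succ _ _ hx, extDeriv, hfderiv.fderiv]
    exact alternatizeUncurryFin_smulRight_comp (dx a) (fderiv ℝ (A.1 k) x)

theorem d_L_pow (m : ℕ) (A : Form n) : d n ((L n ^ m) A) = (L n ^ m) (d n A) := by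
  have hcomm : Commute (d n) (L n) :=
    LinearMap.ext fun A => by simp [L, LinearMap.sum_apply, d_wedgeCoord]
  exact LinearMap.congr_fun (hcomm.pow_right m).eq A

/-- The form whose only component is the restriction of `F` to the disk, in degree `k`. -/
def ofComponent {k : ℕ} (F : Space n → Alt n k) (hF : ContDiffOn ℝ ∞ F (disk n)) : Form n :=
  Form.mk (Pi.single k ((disk n).indicator F)) <| mem_Form.2 fun j => by
    by_cases hj : j = k
    · subst hj
      rw [Pi.single_eq_same]
      exact ⟨hF.congr Set.eqOn_indicator, fun x hx => Set.indicator_of_notMem hx F⟩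
    · rw [Pi.single_eq_of_ne hj]
      exact ⟨contDiffOn_const, fun _ _ => rfl⟩

theorem ofComponent_mem {k : ℕ} (F : Space n → Alt n k) (hF : ContDiffOn ℝ ∞ F (disk n)) :
    ofComponent F hF ∈ homog n k := fun _ hj => Pi.single_eq_of_ne hj _

theorem ofComponent_val {k : ℕ} (F : Space n → Alt n k) (hF : ContDiffOn ℝ ∞ F (disk n)) :
    Set.EqOn ((ofComponent F hF).1 k) F (disk n) := by
  rw [ofComponent, Form.mk_val, Pi.single_eq_same]
  exact Set.eqOn_indicator

theorem d_ofComponent_val {k : ℕ} (F : Space n → Alt n k) (hF : ContDiffOn ℝ ∞ F (disk n))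
    {x : Space n} (hx : x ∈ disk n) : (d n (ofComponent F hF)).1 (k + 1) x = extDeriv F x := by
  rw [d_val_succ _ _ hx]
  exact ((ofComponent_val F hF).eventuallyEq_of_mem ((isOpen_disk n).mem_nhds hx)).extDeriv_eq

theorem exists_d_eq_of_homog {k : ℕ} {A : Form n} (hA : A ∈ homog n (k + 1)) (hd : d n A = 0) :
    ∃ E ∈ homog n k, d n E = A := by
  have hs : StarConvex ℝ 0 (disk n) := (convex_disk n).starConvex (zero_mem_disk n)
  have hAs := (mem_Form.1 A.2 (k + 1)).1
  have hclosed : ∀ x ∈ disk n, extDeriv (A.1 (k + 1)) x = 0 := fun x hx => by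
    rw [← d_val_succ A (k + 1) hx, hd]
    rfl
  have hcone := contDiffOn_conePrimitive (isOpen_disk n) hs hAs
  have hE := ofComponent_mem _ hcone
  refine ⟨_, hE, homog_ext (d_mem_homog hE) hA fun x hx => ?_⟩
  rw [d_ofComponent_val _ _ hx]
  exact extDeriv_conePrimitive (isOpen_disk n) hs (hAs.of_le (by simp)) hclosed hx

/-- The value at the origin of the component of degree zero. It identifies the closed forms of
degree zero with the real numbers. -/
def evalZero (n : ℕ) : Form n →ₗ[ℝ] ℝ where
  toFun A := A.1 0 0 ![]
  map_add' A B := by simp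
  map_smul' c A := by simp

/-- The constant function `1`, as a form. -/
def oneForm (n : ℕ) : Form n :=
  ofComponent (fun _ => constOfIsEmpty ℝ (Space n) (Fin 0) 1) contDiffOn_const

theorem oneForm_mem (n : ℕ) : oneForm n ∈ homog n 0 := ofComponent_mem _ _

theorem evalZero_oneForm (n : ℕ) : evalZero n (oneForm n) = 1 :=
  congrArg (fun B : Alt n 0 => B ![]) (ofComponent_val _ contDiffOn_const (zero_mem_disk n))

theorem d_oneForm (n : ℕ) : d n (oneForm n) = 0 := by
  refine homog_ext (d_mem_homog (oneForm_mem n)) (zero_mem _) fun x hx => ?_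
  rw [oneForm, d_ofComponent_val _ _ hx, extDeriv_constOfIsEmpty, fderiv_const_apply]
  rfl

theorem eq_zero_of_evalZero {A : Form n} (hA : A ∈ homog n 0) (hd : d n A = 0)
    (h0 : evalZero n A = 0) : A = 0 := by
  set f : Space n → ℝ := fun x => A.1 0 x ![]
  have hA₀ : A.1 0 = fun x => constOfIsEmpty ℝ (Space n) (Fin 0) (f x) := by
    funext x
    ext v
    rw [Subsingleton.elim v ![]]
    rfl
  have hdiff : DifferentiableOn ℝ f (disk n) := fun x hx =>
    (((contDiffAt_val A 0 hx).differentiableAt (by simp)).continuousAlternatingMap_apply_const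
      ![]).differentiableWithinAt
  have hfderiv : ∀ x ∈ disk n, fderiv ℝ f x = 0 := fun x hx => by
    have h := d_val_succ A 0 hx
    rw [hd, hA₀, extDeriv_constOfIsEmpty] at h
    exact (ofSubsingleton ℝ (Space n) ℝ (0 : Fin 1)).injective h.symm
  refine homog_ext hA (zero_mem _) fun x hx => ?_
  have hconst : f x = f 0 := (convex_disk n).is_const_of_fderivWithin_eq_zero hdiff
    (fun y hy => by rw [fderivWithin_of_isOpen (isOpen_disk n) hy, hfderiv y hy])
    hx (zero_mem_disk n)
  rw [hA₀]
  change constOfIsEmpty ℝ (Space n) (Fin 0) (f x) = 0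
  rw [hconst, show f 0 = 0 from h0]
  rfl

end Calculus

section Weights

variable {w : ℤ} {A : Form n}

theorem weight_congr {w' : ℤ} (h : w = w') (hA : A ∈ weight n w) : A ∈ weight n w' := h ▸ hA

theorem mem_weight_self : A ∈ weight n n ↔ A ∈ homog n 0 := by
  rw [homog_weight, Nat.cast_zero, sub_zero]

theorem eq_zero_of_lt_weight (hw : n < w) (hA : A ∈ weight n w) : A = 0 := by
  rw [(slTwoData n).bound w (hw.trans_le (le_abs_self w))] at hA
  exact hA

theorem exists_weight_eq_homog (hw : w ≤ n) : ∃ k : ℕ, w = n - k ∧ weight n w = homog n k :=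
  ⟨(n - w).toNat, by omega, if_pos hw⟩

theorem d_mem_weight (hA : A ∈ weight n w) : d n A ∈ weight n (w - 1) := by
  rcases lt_or_ge (n : ℤ) w with hw | hw
  · rw [eq_zero_of_lt_weight hw hA, map_zero]
    exact zero_mem _
  · obtain ⟨k, rfl, hk⟩ := exists_weight_eq_homog hw
    rw [hk] at hA
    have hd := d_mem_homog hA
    rw [homog_weight] at hd
    exact weight_congr (by push_cast; ring) hd

theorem L_pow_mem_weight (m : ℕ) (hA : A ∈ weight n w) : (L n ^ m) A ∈ weight n (w - 2 * m) :=
  (slTwoData n).pow_lower m hA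

theorem exists_d_eq_of_weight_ne (hw : w ≠ n) (hA : A ∈ weight n w) (hd : d n A = 0) :
    ∃ E ∈ weight n (w + 1), d n E = A := by
  rcases lt_or_gt_of_ne hw with hw | hw
  · obtain ⟨k, hk, -⟩ := exists_weight_eq_homog (n := n) (w := w + 1) (by omega)
    have hA' : A ∈ homog n (k + 1) := by
      rw [homog_weight]
      exact weight_congr (by push_cast; omega) hA
    rw [hk, ← homog_weight]
    exact exists_d_eq_of_homog hA' hd
  · exact ⟨0, zero_mem _, by rw [map_zero, eq_zero_of_lt_weight hw hA]⟩

theorem degPart_of_mem {k : ℕ} (hA : A ∈ homog n k) : degPart n k A = A :=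
  homog_ext (degPart_mem k A) hA fun x _ => by simp [degPart]

theorem degPart_of_mem_weight {k : ℕ} (hk : (k : ℤ) ≠ n - w) (hA : A ∈ weight n w) :
    degPart n k A = 0 :=
  homog_ext (degPart_mem k A) (zero_mem _) fun x _ => by simp [degPart, mem_weight.1 hA k hk]

end Weights

section Lefschetz

variable {w : ℤ} {A : Form n}

/-- Indexed by `q` and `r`, the terms `L^r B` are such that the reflection exchanges `q` and `r`. -/
theorem lefschetz_induction {S : Submodule ℝ (Form n)}
    (hS : ∀ q r : ℕ, (q : ℤ) - r = w → ∀ B ∈ weight n (q + r), Lam n B = 0 → (L n ^ r) B ∈ S)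
    (hA : A ∈ weight n w) : A ∈ S := by
  rcases lt_or_ge (n : ℤ) w with hw | hw
  · rw [eq_zero_of_lt_weight hw hA]
    exact zero_mem _
  obtain ⟨k, hk, hwk⟩ := exists_weight_eq_homog hw
  suffices h : A ∈ S.comap (degPart n k) by
    rwa [Submodule.mem_comap, degPart_of_mem (hwk ▸ hA)] at h
  refine (slTwoData n).mem_span _ (fun r v hrv B hB hΛ => ?_) w hA
  obtain ⟨q, rfl⟩ := Nat.exists_eq_add_of_le' hrv
  have hLB : (L n ^ r) B ∈ weight n (q - r) :=
    weight_congr (by push_cast; ring) (L_pow_mem_weight r hB)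
  rw [Submodule.mem_comap]
  by_cases hqr : (q : ℤ) - r = w
  · rw [degPart_of_mem (by rwa [← hwk, ← hqr])]
    exact hS q r hqr B (weight_congr (by push_cast; ring) hB) hΛ
  · rw [degPart_of_mem_weight (by omega) hLB]
    exact zero_mem _

theorem lefschetzPart_eq_zero_of_lt {i : ℕ} (hi : n < i) (A : Form n) :
    lefschetzPart n i A = 0 :=
  form_ext_disk fun s x _ => by
    rw [(lefschetzPart_mem i A).2 s (by omega)]
    rfl

theorem ext_lefschetzPart {A B : Form n} (h : ∀ i, lefschetzPart n i A = lefschetzPart n i B) :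
    A = B := by
  rw [← sum_lefschetzPart A, ← sum_lefschetzPart B]
  simp only [h]

theorem lefschetzPart_L_pow_primitive {r : ℕ} {B : Form n} (hB : B ∈ primitive n r) (i : ℕ) :
    lefschetzPart n i ((L n ^ r) B) = if i = r then B else 0 := by
  rcases lt_or_ge n r with hr | hr
  · have hB₀ : B = 0 := form_ext_disk fun s x _ => by
      rw [hB.2 s (by omega)]
      rfl
    simp [hB₀]
  let b : ∀ j, primitive n j := fun j => ⟨if j = r then B else 0, by
    split_ifs with hj
    · exact hj ▸ hB
    · exact zero_mem _⟩
  have hb : ∀ j, (b j).1 = if j = r then B else 0 := fun _ => rfl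
  have hsum : ∑ j ∈ Finset.range (n + 1), (L n ^ j) (b j).1 = (L n ^ r) B := by
    rw [Finset.sum_eq_single_of_mem r (Finset.mem_range.2 (by omega))
      (fun j _ hj => by rw [hb, if_neg hj, map_zero]), hb, if_pos rfl]
  rw [← hsum, lefschetzPart_unique, hb]

theorem mem_primitive {q r : ℕ} {B : Form n} (hB : B ∈ weight n (q + r)) (hΛ : Lam n B = 0) :
    B ∈ primitive n r :=
  ⟨hΛ, fun s hs => mem_weight.1 hB s (by omega)⟩

theorem L_pow_eq_zero_of_lt {B : Form n} {m : ℕ} (hm : w < m) (hB : B ∈ weight n w)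
    (hΛ : Lam n B = 0) : (L n ^ m) B = 0 := by
  rcases lt_or_ge w 0 with hw | hw
  · rw [(slTwoData n).eq_zero_of_neg hw hB hΛ, map_zero]
  · lift w to ℕ using hw
    obtain ⟨j, rfl⟩ := Nat.exists_eq_add_of_le' (Nat.succ_le_of_lt (Int.ofNat_lt.1 hm))
    rw [pow_add, Module.End.mul_apply, (slTwoData n).pow_eq_zero hB hΛ, map_zero]

theorem lefschetzPart_mem_weight (i : ℕ) (hA : A ∈ weight n w) :
    lefschetzPart n i A ∈ weight n (w + 2 * i) := by
  refine lefschetz_induction (S := (weight n (w + 2 * i)).comap (lefschetzPart n i))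
    (fun q r hqr B hB hΛ => ?_) hA
  rw [Submodule.mem_comap, lefschetzPart_L_pow_primitive (mem_primitive hB hΛ)]
  split_ifs with hir
  · exact weight_congr (by omega) hB
  · exact zero_mem _

theorem lefschetzPart_eq_zero_of_weight {i : ℕ} (hi : w + i < 0) (hA : A ∈ weight n w) :
    lefschetzPart n i A = 0 := by
  refine lefschetz_induction (S := LinearMap.ker (lefschetzPart n i))
    (fun q r hqr B hB hΛ => ?_) hA
  rw [LinearMap.mem_ker, lefschetzPart_L_pow_primitive (mem_primitive hB hΛ), if_neg (by omega)]

theorem lefschetzPart_L_pow (m i : ℕ) (hA : A ∈ weight n w) :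
    lefschetzPart n i ((L n ^ m) A) =
      if m ≤ i ∧ 2 * (m : ℤ) ≤ w + i then lefschetzPart n (i - m) A else 0 := by
  refine lefschetz_induction (S := LinearMap.eqLocus (lefschetzPart n i * L n ^ m)
    (if m ≤ i ∧ 2 * (m : ℤ) ≤ w + i then lefschetzPart n (i - m) else 0))
    (fun q r hqr B hB hΛ => ?_) hA |>.trans (by split_ifs <;> rfl)
  rw [LinearMap.mem_eqLocus]
  change lefschetzPart n i ((L n ^ m * L n ^ r) B) = _
  rw [← pow_add]
  rcases le_or_gt m q with hmq | hmq
  · rw [lefschetzPart_L_pow_primitive (mem_primitive (q := q - m) (weight_congr (by omega) hB) hΛ)]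
    split_ifs with h₁ h₂ h₂
    · rw [lefschetzPart_L_pow_primitive (mem_primitive hB hΛ), if_pos (by omega)]
    · omega
    · rw [lefschetzPart_L_pow_primitive (mem_primitive hB hΛ), if_neg (by omega)]
    · rfl
  · rw [L_pow_eq_zero_of_lt (by omega) hB hΛ, map_zero]
    split_ifs with h
    · rw [lefschetzPart_L_pow_primitive (mem_primitive hB hΛ), if_neg (by omega)]
    · rfl

theorem L_pow_eq_zero_iff {m : ℕ} (hA : A ∈ weight n w) :
    (L n ^ m) A = 0 ↔ ∀ r : ℕ, m ≤ w + r → lefschetzPart n r A = 0 := by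
  refine ⟨fun h r hr => ?_, fun h => ext_lefschetzPart fun i => ?_⟩
  · have hpart := lefschetzPart_L_pow m (r + m) hA
    rwa [h, map_zero, if_pos (by push_cast; omega), Nat.add_sub_cancel, eq_comm] at hpart
  · rw [map_zero, lefschetzPart_L_pow m i hA]
    split_ifs with hi
    · exact h _ (by omega)
    · rfl

theorem eq_zero_of_L_pow_eq_zero {m : ℕ} (hm : m ≤ w) (hA : A ∈ weight n w)
    (h : (L n ^ m) A = 0) : A = 0 :=
  ext_lefschetzPart fun r => by rw [(L_pow_eq_zero_iff hA).1 h r (by omega), map_zero]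

theorem lefschetzPart_Lam (i : ℕ) (hA : A ∈ weight n w) :
    lefschetzPart n i (Lam n A) = (((i : ℝ) + 1) * (w + i + 2)) • lefschetzPart n (i + 1) A := by
  refine lefschetz_induction (S := LinearMap.eqLocus (lefschetzPart n i * Lam n)
    ((((i : ℝ) + 1) * (w + i + 2)) • lefschetzPart n (i + 1))) (fun q r hqr B hB hΛ => ?_) hA
  rw [LinearMap.mem_eqLocus, Module.End.mul_apply, LinearMap.smul_apply,
    lefschetzPart_L_pow_primitive (mem_primitive hB hΛ)]
  rcases r with _ | r
  · rw [pow_zero, Module.End.one_apply, hΛ, map_zero, if_neg (by omega), smul_zero]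
  rw [(slTwoData n).raise_pow r hB hΛ, map_smul, lefschetzPart_L_pow_primitive
    (mem_primitive (q := q + 1) (weight_congr (by push_cast; ring) hB) hΛ)]
  split_ifs with h₁ h₂ h₂
  · subst h₁ hqr
    push_cast
    congr 1
    ring
  · omega
  · omega
  · rw [smul_zero, smul_zero]

theorem Lam_pow_eq_zero_iff (m : ℕ) (hA : A ∈ weight n w) :
    (Lam n ^ m) A = 0 ↔ ∀ r, m ≤ r → lefschetzPart n r A = 0 := by
  induction m generalizing w A with
  | zero =>
    refine ⟨fun h r _ => by rw [show A = 0 from h, map_zero],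
      fun h => ext_lefschetzPart fun r => ?_⟩
    rw [pow_zero, Module.End.one_apply, h r r.zero_le, map_zero]
  | succ m ih =>
    rw [pow_succ, Module.End.mul_apply, ih ((slTwoData n).raise w A hA)]
    have hpart : ∀ r, lefschetzPart n r (Lam n A) = 0 ↔ lefschetzPart n (r + 1) A = 0 := by
      intro r
      rw [lefschetzPart_Lam r hA, smul_eq_zero]
      refine or_iff_right_of_imp fun h => lefschetzPart_eq_zero_of_weight (w := w) ?_ hA
      rcases mul_eq_zero.1 h with h | h
      · exact absurd h (by positivity)
      · have h' : w + r + 2 = 0 := by exact_mod_cast h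
        omega
    simp only [hpart]
    exact ⟨fun h r hr => Nat.sub_add_cancel (by omega : 1 ≤ r) ▸ h (r - 1) (by omega),
      fun h r hr => h (r + 1) (by omega)⟩

theorem mem_filtered {p k : ℕ} :
    A ∈ filtered n p k ↔ A ∈ weight n (n - k) ∧ ∀ r, p < r → lefschetzPart n r A = 0 := by
  rw [filtered, Submodule.mem_inf, homog_weight]
  exact and_congr_right fun hA => Lam_pow_eq_zero_iff (p + 1) hA

end Lefschetz

section Operators

variable {w : ℤ} {A : Form n}

theorem filterProj_apply (p : ℕ) (A : Form n) :
    filterProj n p A = ∑ r ∈ Finset.range (p + 1), (L n ^ r) (lefschetzPart n r A) := by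
  simp only [filterProj, LinearMap.sum_apply, Module.End.mul_apply]

theorem lefschetzPart_filterProj (p i : ℕ) (A : Form n) :
    lefschetzPart n i (filterProj n p A) = if i ≤ p then lefschetzPart n i A else 0 := by
  simp only [filterProj_apply, map_sum, lefschetzPart_L_pow_primitive (lefschetzPart_mem _ A),
    Finset.sum_ite_eq, Finset.mem_range, Nat.lt_succ_iff]

theorem filterProj_eq_zero_iff {p : ℕ} :
    filterProj n p A = 0 ↔ ∀ r ≤ p, lefschetzPart n r A = 0 := by
  refine ⟨fun h r hr => ?_, fun h => ext_lefschetzPart fun i => ?_⟩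
  · rw [← if_pos (c := r ≤ p) (t := lefschetzPart n r A) (e := 0) hr, ← lefschetzPart_filterProj,
      h, map_zero]
  · rw [lefschetzPart_filterProj, map_zero]
    split_ifs with hi
    · exact h i hi
    · rfl

theorem filterProj_mem_weight (p : ℕ) (hA : A ∈ weight n w) : filterProj n p A ∈ weight n w := by
  rw [filterProj_apply]
  exact sum_mem fun r _ =>
    weight_congr (by ring) (L_pow_mem_weight r (lefschetzPart_mem_weight r hA))

theorem filterProj_mem_filtered {k : ℕ} (p : ℕ) (hA : A ∈ homog n k) :
    filterProj n p A ∈ filtered n p k := by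
  rw [homog_weight] at hA
  exact mem_filtered.2 ⟨filterProj_mem_weight p hA, fun r hr => by
    rw [lefschetzPart_filterProj, if_neg (by omega)]⟩

theorem filterProj_of_mem_filtered {p k : ℕ} (hA : A ∈ filtered n p k) :
    filterProj n p A = A :=
  ext_lefschetzPart fun i => by
    rw [lefschetzPart_filterProj]
    split_ifs with hi
    · rfl
    · exact ((mem_filtered.1 hA).2 i (by omega)).symm

theorem filterProj_L_pow (p : ℕ) (hA : A ∈ weight n w) :
    filterProj n p ((L n ^ (p + 1)) A) = 0 :=
  filterProj_eq_zero_iff.2 fun r hr => by rw [lefschetzPart_L_pow _ _ hA, if_neg (by omega)]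

theorem exists_eq_filterProj_add (p : ℕ) (hA : A ∈ weight n w) :
    ∃ G ∈ weight n (w + 2 * (p + 1)), A = filterProj n p A + (L n ^ (p + 1)) G := by
  suffices h : A ∈ ((weight n (w + 2 * (p + 1))).map (L n ^ (p + 1))).comap
      (1 - filterProj n p) by
    obtain ⟨G, hG, hGA⟩ := Submodule.mem_comap.1 h
    exact ⟨G, hG, by simp [hGA]⟩
  refine lefschetz_induction (fun q r hqr B hB hΛ => ?_) hA
  have hpart := lefschetzPart_L_pow_primitive (mem_primitive hB hΛ)
  rcases le_or_gt r p with hr | hr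
  · have hLB : (L n ^ r) B - filterProj n p ((L n ^ r) B) = 0 := sub_eq_zero.2 <|
      ext_lefschetzPart fun i => by
        rw [lefschetzPart_filterProj, hpart]
        split_ifs <;> first | rfl | omega
    exact ⟨0, zero_mem _, by rw [map_zero]; exact hLB.symm⟩
  · obtain ⟨j, rfl⟩ := Nat.exists_eq_add_of_lt hr
    refine ⟨(L n ^ j) B, weight_congr (by omega) (L_pow_mem_weight j hB), ?_⟩
    have hLB : filterProj n p ((L n ^ (p + j + 1)) B) = 0 :=
      filterProj_eq_zero_iff.2 fun i hi => by rw [hpart, if_neg (by omega)]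
    rw [LinearMap.sub_apply, hLB, sub_zero, Module.End.one_apply, ← Module.End.mul_apply,
      ← pow_add, Nat.add_right_comm]

theorem starR_L_pow {q r : ℕ} {B : Form n} (hB : B ∈ weight n (q + r)) (hΛ : Lam n B = 0) :
    starR n ((L n ^ r) B) = (L n ^ q) B := by
  rcases lt_or_ge n (q + r) with hqr | hqr
  · rw [eq_zero_of_lt_weight (by omega) hB]
    simp only [map_zero]
  simp only [starR, LinearMap.sum_apply, Module.End.mul_apply,
    lefschetzPart_L_pow_primitive (mem_primitive hB hΛ)]
  rw [Finset.sum_eq_single_of_mem r (Finset.mem_range.2 (by omega))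
      (fun j _ hj => by simp only [if_neg hj, map_zero, Finset.sum_const_zero]),
    Finset.sum_eq_single_of_mem (n - r - q) (Finset.mem_range.2 (by omega))
      (fun s _ hs => by rw [if_pos rfl, degPart_of_mem_weight (by omega) hB, map_zero]),
    if_pos rfl, degPart_of_mem, show n - r - (n - r - q) = q by omega]
  rw [homog_weight]
  exact weight_congr (by omega) hB

theorem starR_mem_weight (hA : A ∈ weight n w) : starR n A ∈ weight n (-w) := by
  refine lefschetz_induction (S := (weight n (-w)).comap (starR n)) (fun q r hqr B hB hΛ => ?_) hA
  rw [Submodule.mem_comap, starR_L_pow hB hΛ]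
  exact weight_congr (by omega) (L_pow_mem_weight q hB)

theorem starR_starR (hA : A ∈ weight n w) : starR n (starR n A) = A := by
  refine lefschetz_induction (S := LinearMap.eqLocus (starR n * starR n) 1)
    (fun q r _ B hB hΛ => ?_) hA
  rw [LinearMap.mem_eqLocus, Module.End.mul_apply, starR_L_pow hB hΛ,
    starR_L_pow (weight_congr (add_comm _ _) hB) hΛ, Module.End.one_apply]

theorem L_pow_starR {m : ℕ} (hA : A ∈ weight n (-m)) : (L n ^ m) (starR n A) = A := by
  refine lefschetz_induction (S := LinearMap.eqLocus (L n ^ m * starR n) 1)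
    (fun q r hqr B hB hΛ => ?_) hA
  rw [LinearMap.mem_eqLocus, Module.End.mul_apply, starR_L_pow hB hΛ, ← Module.End.mul_apply,
    ← pow_add, Module.End.one_apply, show m + q = r by omega]

theorem lefschetzPart_starR (i : ℕ) (hA : A ∈ weight n w) :
    lefschetzPart n i (starR n A) = if w ≤ i then lefschetzPart n (i - w).toNat A else 0 := by
  refine lefschetz_induction (S := LinearMap.eqLocus (lefschetzPart n i * starR n)
    (if w ≤ i then lefschetzPart n (i - w).toNat else 0)) (fun q r hqr B hB hΛ => ?_) hA
    |>.trans (by split_ifs <;> rfl)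
  have hstar := lefschetzPart_L_pow_primitive
    (mem_primitive (q := r) (weight_congr (add_comm _ _) hB) hΛ) i
  rw [LinearMap.mem_eqLocus, Module.End.mul_apply, starR_L_pow hB hΛ, hstar]
  split_ifs with h₁ h₂ h₂
  · rw [lefschetzPart_L_pow_primitive (mem_primitive hB hΛ), if_pos (by omega)]
  · omega
  · rw [lefschetzPart_L_pow_primitive (mem_primitive hB hΛ), if_neg (by omega)]
  · rfl

theorem L_pow_starR_eq_zero_iff (m : ℕ) (hA : A ∈ weight n w) :
    (L n ^ m) (starR n A) = 0 ↔ ∀ r, m ≤ r → lefschetzPart n r A = 0 := by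
  rw [L_pow_eq_zero_iff (starR_mem_weight hA)]
  refine ⟨fun h r hr => ?_, fun h r hr => ?_⟩
  · rcases lt_or_ge (w + r) 0 with hw | hw
    · exact lefschetzPart_eq_zero_of_weight hw hA
    · have hpart := h (w + r).toNat (by omega)
      rwa [lefschetzPart_starR _ hA, if_pos (by omega),
        show (((w + r).toNat : ℤ) - w).toNat = r by omega] at hpart
  · rw [lefschetzPart_starR _ hA, if_pos (by omega)]
    exact h _ (by omega)

end Operators

section Middle

variable {A : Form n} {p : ℕ}

theorem delPlus_L_pow {r : ℕ} {B : Form n} (hB : B ∈ primitive n r) :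
    delPlus n ((L n ^ r) B) = (L n ^ r) (lefschetzPart n r (d n ((L n ^ r) B))) := by
  simp only [delPlus, LinearMap.sum_apply, Module.End.mul_apply, lefschetzPart_L_pow_primitive hB]
  refine (Finset.sum_eq_single r (fun j _ hj => ?_) fun hr => ?_).trans (by rw [if_pos rfl])
  · simp only [if_neg hj, map_zero]
  · rw [lefschetzPart_eq_zero_of_lt (by rw [Finset.mem_range] at hr; omega), map_zero]

theorem delMinus_L_pow {r : ℕ} {B : Form n} (hB : B ∈ primitive n r) :
    delMinus n ((L n ^ r) B) = (L n ^ r) (lefschetzPart n (r + 1) (d n ((L n ^ r) B))) := by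
  simp only [delMinus, LinearMap.sum_apply, Module.End.mul_apply,
    lefschetzPart_L_pow_primitive hB]
  refine (Finset.sum_eq_single r (fun j _ hj => ?_) fun hr => ?_).trans (by rw [if_pos rfl])
  · simp only [if_neg hj, map_zero]
  · rw [lefschetzPart_eq_zero_of_lt (by rw [Finset.mem_range] at hr; omega), map_zero]

theorem L_pow_lefschetzPart_of_mem_filtered (hA : A ∈ filtered n p (n + p)) :
    (L n ^ p) (lefschetzPart n p A) = A := by
  obtain ⟨hAw, hA₀⟩ := mem_filtered.1 hA
  refine ext_lefschetzPart fun i => ?_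
  rw [lefschetzPart_L_pow_primitive (lefschetzPart_mem p A)]
  split_ifs with hi
  · rw [hi]
  · rcases lt_or_gt_of_ne hi with hi | hi
    · exact (lefschetzPart_eq_zero_of_weight (by push_cast; omega) hAw).symm
    · exact (hA₀ i hi).symm

theorem lefschetzPart_zero_d {C : Form n} (hC : C ∈ weight n (p + 1))
    (hdC : (L n ^ (p + 1)) (d n C) = 0) :
    lefschetzPart n 0 (d n (lefschetzPart n 0 C)) = d n C := by
  have hdCw : d n C ∈ weight n p := weight_congr (by ring) (d_mem_weight hC)
  obtain ⟨G, hG, hCG⟩ := exists_eq_filterProj_add 0 hC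
  have hpart : lefschetzPart n 0 (d n C) = lefschetzPart n 0 (d n (lefschetzPart n 0 C)) := by
    conv_lhs => rw [hCG, map_add, map_add, d_L_pow, lefschetzPart_L_pow _ _ (d_mem_weight hG),
      if_neg (by omega), add_zero]
    rw [filterProj_apply, Finset.sum_range_one, pow_zero, Module.End.one_apply]
  rw [← hpart]
  refine ext_lefschetzPart fun i => ?_
  have h := lefschetzPart_L_pow_primitive (lefschetzPart_mem 0 (d n C)) i
  rw [pow_zero, Module.End.one_apply] at h
  rw [h]
  split_ifs with hi
  · rw [hi]
  · exact ((L_pow_eq_zero_iff hdCw).1 hdC i (by omega)).symm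

theorem delPlus_delMinus_apply {C : Form n} (hA : A ∈ filtered n p (n + p))
    (hC : C ∈ weight n (p + 1)) (hAC : d n A = (L n ^ (p + 1)) C) :
    (delPlus n * delMinus n) A = (L n ^ p) (d n C) := by
  have hdC : (L n ^ (p + 1)) (d n C) = 0 := by rw [← d_L_pow, ← hAC, d_d]
  have hC₀ : lefschetzPart n 0 C ∈ weight n (p + 1) :=
    weight_congr (by simp) (lefschetzPart_mem_weight 0 hC)
  have hC₀p : lefschetzPart n 0 C ∈ primitive n p :=
    mem_primitive (q := 1) (weight_congr (by push_cast; ring) hC₀) (lefschetzPart_mem 0 C).1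
  have hminus : delMinus n A = (L n ^ p) (lefschetzPart n 0 C) := by
    rw [← L_pow_lefschetzPart_of_mem_filtered hA, delMinus_L_pow (lefschetzPart_mem p A),
      L_pow_lefschetzPart_of_mem_filtered hA, hAC, lefschetzPart_L_pow _ _ hC,
      if_pos (by push_cast; omega), Nat.sub_self]
  rw [Module.End.mul_apply, hminus, delPlus_L_pow hC₀p, d_L_pow,
    lefschetzPart_L_pow _ _ (d_mem_weight hC₀), if_pos (by omega), Nat.sub_self,
    lefschetzPart_zero_d hC hdC]

end Middle

section FirstHalf

variable {A : Form n} {p k : ℕ}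

theorem dPlus_eq_zero_iff {w : ℤ} (hA : A ∈ weight n w) :
    dPlus n p A = 0 ↔ ∃ C ∈ weight n (w + 2 * p + 1), d n A = (L n ^ (p + 1)) C := by
  rw [dPlus, Module.End.mul_apply]
  refine ⟨fun h => ?_, fun ⟨C, hC, hAC⟩ => by rw [hAC, filterProj_L_pow p hC]⟩
  obtain ⟨C, hC, hAC⟩ := exists_eq_filterProj_add p (d_mem_weight hA)
  exact ⟨C, weight_congr (by ring) hC, by rwa [h, zero_add] at hAC⟩

theorem dPlus_eq_zero_of_weight {w : ℤ} (hw : w + p ≤ 0) (hA : A ∈ weight n w) :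
    dPlus n p A = 0 :=
  filterProj_eq_zero_iff.2 fun _ _ => lefschetzPart_eq_zero_of_weight (by omega) (d_mem_weight hA)

theorem mem_cocyclesPlus_iff (hk : k ≤ n + p) :
    A ∈ cocyclesPlus n p k ↔ A ∈ filtered n p k ∧
      ∃ C ∈ weight n (n - k + 2 * p + 1), d n A = (L n ^ (p + 1)) C ∧ d n C = 0 := by
  rw [cocyclesPlus, Submodule.mem_inf]
  refine and_congr_right fun hA => ?_
  have hAw := (mem_filtered.1 hA).1
  have hinj : ∀ C ∈ weight n (n - k + 2 * p + 1), ∀ m : ℕ, (m : ℤ) ≤ n - k + 2 * p →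
      (L n ^ m) (d n C) = 0 → d n C = 0 := fun C hC m hm h =>
    eq_zero_of_L_pow_eq_zero (by omega) (d_mem_weight hC) h
  split_ifs with hkp
  · rw [LinearMap.mem_ker, dPlus_eq_zero_iff hAw]
    refine exists_congr fun C => and_congr_right fun hC => (and_iff_left_of_imp fun hAC => ?_).symm
    exact hinj C hC (p + 1) (by push_cast; omega) (by rw [← d_L_pow, ← hAC, d_d])
  · obtain rfl : k = n + p := by omega
    have hmid : ∀ C ∈ weight n (n - (n + p : ℕ) + 2 * p + 1), d n A = (L n ^ (p + 1)) C →
        (delPlus n * delMinus n) A = (L n ^ p) (d n C) := fun C hC =>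
      delPlus_delMinus_apply hA (weight_congr (by push_cast; ring) hC)
    obtain ⟨C, hC, hAC⟩ :=
      (dPlus_eq_zero_iff hAw).1 (dPlus_eq_zero_of_weight (p := p) (by push_cast; omega) hAw)
    refine ⟨fun h => ⟨C, hC, hAC, hinj C hC p (by push_cast; omega) ?_⟩, ?_⟩
    · rwa [← hmid C hC hAC]
    · rintro ⟨C', hC', hAC', hdC'⟩
      rw [LinearMap.mem_ker, hmid C' hC' hAC', hdC', map_zero]

theorem mem_coboundariesPlus_succ_iff :
    A ∈ coboundariesPlus n p (k + 1) ↔ A ∈ filtered n p (k + 1) ∧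
      ∃ E ∈ weight n (n - k + 2 * p + 1), d n A = (L n ^ (p + 1)) (d n E) := by
  constructor
  · rintro ⟨F, hF, rfl⟩
    have hFk := (Submodule.mem_inf.1 hF).1
    refine ⟨filterProj_mem_filtered p (d_mem_homog hFk), ?_⟩
    obtain ⟨G, hG, hFG⟩ := exists_eq_filterProj_add p (d_mem_weight (homog_weight ▸ hFk))
    refine ⟨-G, neg_mem (weight_congr (by ring) hG), ?_⟩
    rw [dPlus, Module.End.mul_apply, eq_sub_of_add_eq hFG.symm, map_sub, d_d, d_L_pow, map_neg,
      map_neg, zero_sub]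
  · rintro ⟨hA, E, hE, hAE⟩
    have hLE : (L n ^ (p + 1)) E ∈ homog n (k + 1) := by
      rw [homog_weight]
      exact weight_congr (by push_cast; ring) (L_pow_mem_weight (p + 1) hE)
    obtain ⟨F, hF, hFA⟩ := exists_d_eq_of_homog (sub_mem (Submodule.mem_inf.1 hA).1 hLE)
      (by rw [map_sub, d_L_pow, hAE, sub_self])
    obtain ⟨G, hG, hFG⟩ := exists_eq_filterProj_add p (homog_weight ▸ hF)
    refine ⟨filterProj n p F, filterProj_mem_filtered p hF, ?_⟩
    rw [dPlus, Module.End.mul_apply, eq_sub_of_add_eq hFG.symm, map_sub, map_sub, hFA, map_sub,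
      filterProj_of_mem_filtered hA, filterProj_L_pow p hE, d_L_pow,
      filterProj_L_pow p (d_mem_weight hG), sub_zero, sub_zero]

theorem homog_zero_le_filtered (n p : ℕ) : homog n 0 ≤ filtered n p 0 := fun A hA => by
  rw [homog_weight] at hA
  exact mem_filtered.2 ⟨hA, fun r _ =>
    eq_zero_of_lt_weight (by push_cast; omega) (lefschetzPart_mem_weight r hA)⟩

theorem mem_primitive_of_homog_zero {r : ℕ} (hr : r ≤ n) (hA : A ∈ homog n 0) :
    A ∈ primitive n r :=
  ⟨Lam_eq_zero two_pos hA, fun s hs => hA s (by omega)⟩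

theorem rank_HPlus_zero (n p : ℕ) : Module.rank ℝ (HPlus n p 0) = 1 := by
  have hone : oneForm n ∈ cocyclesPlus n p 0 := (mem_cocyclesPlus_iff (Nat.zero_le _)).2
    ⟨homog_zero_le_filtered n p (oneForm_mem n), 0, zero_mem _, by rw [d_oneForm, map_zero],
      map_zero _⟩
  refine rank_quotient_submoduleOf_eq_one (evalZero n) (fun A hA => ?_)
    ⟨oneForm n, hone, evalZero_oneForm n⟩
  obtain ⟨hAf, C, hC, hAC, -⟩ := (mem_cocyclesPlus_iff (Nat.zero_le _)).1 hA
  rw [eq_zero_of_lt_weight (by push_cast; omega) hC, map_zero] at hAC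
  rw [coboundariesPlus, Submodule.mem_bot]
  exact ⟨fun h => by rw [h, map_zero], eq_zero_of_evalZero (Submodule.mem_inf.1 hAf).1 hAC⟩

theorem exists_mem_filtered_d_eq (p : ℕ) :
    ∃ A ∈ filtered n p (2 * p + 1), d n A = (L n ^ (p + 1)) (oneForm n) := by
  have hL : (L n ^ (p + 1)) (oneForm n) ∈ homog n (2 * p + 1 + 1) := by
    rw [homog_weight]
    exact weight_congr (by push_cast; ring)
      (L_pow_mem_weight (p + 1) (mem_weight_self.2 (oneForm_mem n)))
  obtain ⟨B, hB, hdB⟩ := exists_d_eq_of_homog hL (by rw [d_L_pow, d_oneForm, map_zero])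
  obtain ⟨G, hG, hBG⟩ := exists_eq_filterProj_add p (homog_weight ▸ hB)
  refine ⟨filterProj n p B, filterProj_mem_filtered p hB, ?_⟩
  rw [eq_sub_of_add_eq hBG.symm, eq_zero_of_lt_weight (by push_cast; omega) hG, map_zero,
    sub_zero, hdB]

theorem rank_HPlus_two_mul_add_one (hp : p < n) : Module.rank ℝ (HPlus n p (2 * p + 1)) = 1 := by
  have hk : 2 * p + 1 ≤ n + p := by omega
  have hpart {B C : Form n} (hC : C ∈ homog n 0) (hBC : d n B = (L n ^ (p + 1)) C) :
      lefschetzPart n (p + 1) (d n B) = C := by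
    rw [hBC, lefschetzPart_L_pow_primitive (mem_primitive_of_homog_zero hp hC), if_pos rfl]
  refine rank_quotient_submoduleOf_eq_one (evalZero n ∘ₗ lefschetzPart n (p + 1) ∘ₗ d n)
    (fun A hA => ?_) ?_
  · obtain ⟨hAf, C, hC, hAC, hdC⟩ := (mem_cocyclesPlus_iff hk).1 hA
    have hC₀ : C ∈ homog n 0 := mem_weight_self.1 (weight_congr (by push_cast; ring) hC)
    rw [LinearMap.comp_apply, LinearMap.comp_apply, hpart hC₀ hAC, mem_coboundariesPlus_succ_iff]
    constructor
    · rintro ⟨-, E, hE, hAE⟩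
      rw [eq_zero_of_lt_weight (by push_cast; omega) hE, map_zero] at hAE
      rw [← hpart hC₀ hAC, hpart (zero_mem _) hAE, map_zero]
    · intro h
      rw [eq_zero_of_evalZero hC₀ hdC h] at hAC
      exact ⟨hAf, 0, zero_mem _, by simp only [hAC, map_zero]⟩
  · obtain ⟨A, hA, hdA⟩ := exists_mem_filtered_d_eq p
    refine ⟨A, (mem_cocyclesPlus_iff hk).2 ⟨hA, oneForm n, ?_, hdA, d_oneForm n⟩, ?_⟩
    · exact weight_congr (by push_cast; ring) (mem_weight_self.2 (oneForm_mem n))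
    · rw [LinearMap.comp_apply, LinearMap.comp_apply, hpart (oneForm_mem n) hdA, evalZero_oneForm]

theorem rank_HPlus_eq_zero (hk : k + 1 ≤ n + p) (hkp : k ≠ 2 * p) :
    Module.rank ℝ (HPlus n p (k + 1)) = 0 := by
  refine rank_quotient_submoduleOf_eq_zero fun A hA => ?_
  obtain ⟨hAf, C, hC, hAC, hdC⟩ := (mem_cocyclesPlus_iff hk).1 hA
  obtain ⟨E, hE, rfl⟩ := exists_d_eq_of_weight_ne (by omega) hC hdC
  exact mem_coboundariesPlus_succ_iff.2 ⟨hAf, E, weight_congr (by push_cast; ring) hE, hAC⟩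

end FirstHalf

section SecondHalf

variable {A : Form n} {p k : ℕ}

theorem mem_cocyclesMinus_iff :
    A ∈ cocyclesMinus n p k ↔ A ∈ filtered n p k ∧ d n (starR n A) = 0 := by
  rw [cocyclesMinus, Submodule.mem_inf]
  refine and_congr_right fun hA => ?_
  have hdA := d_mem_weight (starR_mem_weight (mem_filtered.1 hA).1)
  rw [LinearMap.mem_ker, dMinus, Module.End.mul_apply, Module.End.mul_apply]
  refine ⟨fun h => ?_, fun h => by rw [h, map_zero]⟩
  rw [← starR_starR hdA, h, map_zero]

theorem exists_d_eq_starR (hk : k ≤ n + p) (hkn : k ≠ 2 * n) (hA : A ∈ cocyclesMinus n p k) :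
    ∃ E ∈ weight n (k - n + 1), ∃ F ∈ weight n (k - n - 2 * p),
      d n E = starR n A ∧ d n F = (L n ^ (p + 1)) E ∧ ∀ r, p < r → lefschetzPart n r F = 0 := by
  obtain ⟨hAf, hdA⟩ := mem_cocyclesMinus_iff.1 hA
  obtain ⟨hAw, hAp⟩ := mem_filtered.1 hAf
  obtain ⟨E, hE, hdE⟩ := exists_d_eq_of_weight_ne (by omega) (starR_mem_weight hAw) hdA
  obtain ⟨F, hF, hdF⟩ := exists_d_eq_of_weight_ne (by omega) (L_pow_mem_weight (p + 1) hE)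
    (by rw [d_L_pow, hdE, (L_pow_starR_eq_zero_iff (p + 1) hAw).2 hAp])
  obtain ⟨G, hG, hFG⟩ := exists_eq_filterProj_add p hF
  refine ⟨E - d n G, sub_mem (weight_congr (by ring) hE)
      (weight_congr (by push_cast; ring) (d_mem_weight hG)),
    filterProj n p F, weight_congr (by push_cast; ring) (filterProj_mem_weight p hF), ?_, ?_,
    fun r hr => by rw [lefschetzPart_filterProj, if_neg (by omega)]⟩
  · rw [map_sub, d_d, sub_zero, hdE]
  · rw [eq_sub_of_add_eq hFG.symm, map_sub, d_L_pow, hdF, map_sub]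

theorem rank_HMinus_of_lt (hk : k < n + p) (hkn : k ≠ 2 * n) :
    Module.rank ℝ (HMinus n p k) = 0 := by
  refine rank_quotient_submoduleOf_eq_zero fun A hA => ?_
  have hAw := (mem_filtered.1 (mem_cocyclesMinus_iff.1 hA).1).1
  obtain ⟨E, hE, F, hF, hdE, hdF, hFp⟩ := exists_d_eq_starR hk.le hkn hA
  have hF₀ : F = 0 := by
    refine ext_lefschetzPart fun r => ?_
    rw [map_zero]
    rcases lt_or_ge p r with hr | hr
    · exact hFp r hr
    · exact lefschetzPart_eq_zero_of_weight (by omega) hF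
  rw [hF₀, map_zero] at hdF
  rw [coboundariesMinus, if_pos hk]
  refine ⟨starR n E, mem_filtered.2
    ⟨weight_congr (by push_cast; ring) (starR_mem_weight hE), ?_⟩, ?_⟩
  · refine (L_pow_starR_eq_zero_iff (p + 1) (starR_mem_weight hE)).1 ?_
    rw [starR_starR hE, hdF]
  · rw [dMinus, Module.End.mul_apply, Module.End.mul_apply, starR_starR hE, hdE, starR_starR hAw]

theorem rank_HMinus_top (hp : p < n) : Module.rank ℝ (HMinus n p (n + p)) = 0 := by
  refine rank_quotient_submoduleOf_eq_zero fun A hA => ?_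
  have hAw := (mem_filtered.1 (mem_cocyclesMinus_iff.1 hA).1).1
  obtain ⟨E, hE, F, hF, hdE, hdF, hFp⟩ := exists_d_eq_starR le_rfl (by omega) hA
  rw [coboundariesMinus, if_neg (lt_irrefl _)]
  have hFf : F ∈ filtered n p (n + p) :=
    mem_filtered.2 ⟨weight_congr (by push_cast; ring) hF, hFp⟩
  refine ⟨F, hFf, ?_⟩
  rw [delPlus_delMinus_apply hFf (weight_congr (by push_cast; ring) hE) hdF, hdE,
    L_pow_starR (weight_congr (by push_cast; ring) hAw)]

theorem coboundariesMinus_self_two_mul (n : ℕ) : coboundariesMinus n n (2 * n) = ⊥ := by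
  rw [two_mul, coboundariesMinus, if_neg (lt_irrefl _), Submodule.eq_bot_iff]
  rintro _ ⟨F, hF, rfl⟩
  have hFw := (mem_filtered.1 hF).1
  obtain ⟨C, hC, hFC⟩ := (dPlus_eq_zero_iff (p := n) hFw).1
    (dPlus_eq_zero_of_weight (by push_cast; omega) hFw)
  rw [delPlus_delMinus_apply hF (weight_congr (by push_cast; ring) hC) hFC,
    eq_zero_of_lt_weight (by push_cast; omega) hC, map_zero, map_zero]

theorem rank_HMinus_self_two_mul (n : ℕ) : Module.rank ℝ (HMinus n n (2 * n)) = 1 := by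
  have hone := mem_weight_self.2 (oneForm_mem n)
  refine rank_quotient_submoduleOf_eq_one (evalZero n ∘ₗ starR n) (fun A hA => ?_)
    ⟨starR n (oneForm n), mem_cocyclesMinus_iff.2 ⟨mem_filtered.2
      ⟨weight_congr (by push_cast; ring) (starR_mem_weight hone),
        fun r hr => lefschetzPart_eq_zero_of_lt hr _⟩, ?_⟩, ?_⟩
  · obtain ⟨hAf, hdA⟩ := mem_cocyclesMinus_iff.1 hA
    have hAw := (mem_filtered.1 hAf).1
    rw [coboundariesMinus_self_two_mul, Submodule.mem_bot, LinearMap.comp_apply]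
    refine ⟨fun h => by rw [h, map_zero, map_zero], fun h => ?_⟩
    rw [← starR_starR hAw, eq_zero_of_evalZero (mem_weight_self.1
      (weight_congr (by push_cast; ring) (starR_mem_weight hAw))) hdA h, map_zero]
  · rw [starR_starR hone, d_oneForm]
  · rw [LinearMap.comp_apply, starR_starR hone, evalZero_oneForm]

end SecondHalf

theorem rank_HPlus {p k : ℕ} (hk : k ≤ n + p) :
    Module.rank ℝ (HPlus n p k) = if k = 0 ∨ k = 2 * p + 1 then 1 else 0 := by
  rcases k with _ | k
  · rw [rank_HPlus_zero, if_pos (Or.inl rfl)]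
  · rcases eq_or_ne k (2 * p) with rfl | hkp
    · rw [rank_HPlus_two_mul_add_one (by omega), if_pos (Or.inr rfl)]
    · rw [rank_HPlus_eq_zero hk hkp, if_neg (by omega)]

theorem rank_HMinus {p k : ℕ} (hp : p ≤ n) (hk : k ≤ n + p) :
    Module.rank ℝ (HMinus n p k) = if k = 2 * n then 1 else 0 := by
  split_ifs with hkn
  · obtain rfl : p = n := by omega
    rw [hkn, rank_HMinus_self_two_mul]
  · rcases hk.lt_or_eq with hk | rfl
    · exact rank_HMinus_of_lt hk hkn
    · exact rank_HMinus_top (by omega)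

theorem index_eq_zero {p : ℕ} (hp : p ≤ n) : index n p = 0 := by
  have hplus : ∀ k ∈ Finset.range (n + p + 1),
      (-1 : ℤ) ^ k * (Module.finrank ℝ (HPlus n p k) : ℤ) =
        (if k = 0 then 1 else 0) - if k = 2 * p + 1 then 1 else 0 := fun k hk => by
    rw [Module.finrank, rank_HPlus (Nat.lt_succ_iff.1 (Finset.mem_range.1 hk))]
    rcases eq_or_ne k 0 with rfl | hk₀
    · simp
    · rcases eq_or_ne k (2 * p + 1) with rfl | hkp
      · simp [pow_succ, pow_mul]
      · simp [hk₀, hkp]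
  have hminus : ∀ k ∈ Finset.range (n + p + 1),
      (-1 : ℤ) ^ (2 * n + 2 * p + 1 - k) * (Module.finrank ℝ (HMinus n p k) : ℤ) =
        -if k = 2 * n then 1 else 0 := fun k hk => by
    rw [Module.finrank, rank_HMinus hp (Nat.lt_succ_iff.1 (Finset.mem_range.1 hk))]
    rcases eq_or_ne k (2 * n) with rfl | hkn
    · rw [show 2 * n + 2 * p + 1 - 2 * n = 2 * p + 1 by omega]
      simp [pow_succ, pow_mul]
    · simp [hkn]
  rw [index, Finset.sum_congr rfl hplus, Finset.sum_congr rfl hminus, Finset.sum_sub_distrib,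
    Finset.sum_neg_distrib]
  simp only [Finset.sum_ite_eq', Finset.mem_range]
  rcases hp.lt_or_eq with h | rfl
  · rw [if_pos (by omega), if_pos (by omega), if_neg (by omega), sub_self, neg_zero, add_zero]
  · rw [if_pos (by omega), if_neg (by omega), if_pos (by omega), sub_zero, add_neg_cancel]

end FilteredForms

theorem proposition3p2_general {n p : ℕ} (hp : p ≤ n) :
    (∀ k ≤ n + p, Module.rank ℝ (FilteredForms.HPlus n p k) =
      if k = 0 ∨ k = 2 * p + 1 then 1 else 0) ∧
    (∀ k ≤ n + p, Module.rank ℝ (FilteredForms.HMinus n p k) = if k = 2 * n then 1 else 0) ∧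
    FilteredForms.index n p = 0 :=
  ⟨fun _ => FilteredForms.rank_HPlus, fun _ => FilteredForms.rank_HMinus hp,
    FilteredForms.index_eq_zero hp⟩

end

theorem proposition3p2 (n p : ℕ) :
    (p < n →
      Module.rank ℝ (FilteredForms.HPlus n p 0) = 1 ∧
      Module.rank ℝ (FilteredForms.HPlus n p (2 * p + 1)) = 1 ∧
      ∀ k, 1 ≤ k → k ≤ n + p - 1 → k ≠ 2 * p + 1 →
        Module.rank ℝ (FilteredForms.HPlus n p k) = 0) ∧
    (0 < p → p < n →
      ∀ k, k ≤ n + p - 1 → Module.rank ℝ (FilteredForms.HMinus n p k) = 0) ∧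
    (p ≤ n →
      (∀ k, k ≤ n + p → Module.Finite ℝ (FilteredForms.HPlus n p k) ∧
        Module.Finite ℝ (FilteredForms.HMinus n p k)) ∧
      FilteredForms.index n p = 0) := by
  refine ⟨fun hp => ⟨?_, ?_, fun k _ _ _ => ?_⟩, fun _ hp k _ => ?_, fun hp => ⟨fun k hk =>
    ⟨finite_of_rank_eq_ite ((proposition3p2_general hp).1 k hk),
      finite_of_rank_eq_ite ((proposition3p2_general hp).2.1 k hk)⟩,
    (proposition3p2_general hp).2.2⟩⟩
  · rw [(proposition3p2_general hp.le).1 0 (by omega), if_pos (by omega)]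
  · rw [(proposition3p2_general hp.le).1 _ (by omega), if_pos (by omega)]
  · rw [(proposition3p2_general hp.le).1 k (by omega), if_neg (by omega)]
  · rw [(proposition3p2_general hp.le).2.1 k (by omega), if_neg (by omega)]
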